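/- Let $c_p,c_d\ge 0$, $c_t>0$, $r\ge 0$, put $c_{pd}=c_p+c_d$ and $\kappa=\frac{2+\sqrt2+5\ln(1+\sqrt2)}{15}\approx 0.52$. Let $\rho_n\ge 0$ satisfy $n\rho_n^2\to 0$. For each $n$ draw start locations $s_1,\dots,s_n$ and goal locations $g_1,\dots,g_n$ of $n$ objects independently and uniformly in the unit square $[0,1]^2$, conditioned on being non-overlapping, i.e. on the $2n$ closed discs of radius $\rho_n$ around them being pairwise disjoint (for $\rho_n=0$: on the locations being distinct). The optimal single-arm cost is $$C_{\rm single}=n c_{pd}+c_t\sum_{i}|s_i-g_i|+c_t\min_{\sigma}\sum_{j}|g_{\sigma(j)}-s_{\sigma(j+1)}|,$$ the minimum being over all orders $\sigma$ of the objects, with $\sigma(n+1)=\sigma(1)$. A 2-arm solution consists of an assignment of each object to one of two arms, and of closed paths in the plane, followed during a time interval $[0,T]$, for the two arms, on which a unit of distance takes time at least $c_t$; each arm moves its objects one after the other, resting at $s_i$ for a time $c_p$ to pick up object $i$ and later at $g_i$ for a time $c_d$ to drop it. The arms are discs of radius $r$, and at all times in $[0,T]$ at which no pickup or drop-off is being performed,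 their centres have distance at least $2r$ (pickups and drop-offs are assumed not to cause collisions between the arms). The cost of the solution is its makespan $T$. **Theorem.** For all sufficiently large $n$ the conditioning event has positive probability, and for every $\varepsilon>0$, with probability tending to $1$ as $n\to\infty$: 1. $\left|\frac{C_{\rm single}}{n}-(c_{pd}+\kappa c_t)\right|\le\varepsilon$; 2. there is a 2-arm solution with makespan at most $\left(\frac12+\frac{4\pi r c_t}{c_{pd}+\kappa c_t}+\varepsilon\right)C_{\rm single}$; 3. every 2-arm solution has makespan at least $\left(\frac12-\varepsilon\right)C_{\rm single}$. So the optimal 2-arm makespan is asymptotically $\frac12$ of the optimal single-arm cost, up to an additive collision-avoidance term between $0$ and $\frac{4\pi r c_t}{c_{pd}+\kappa c_t}$ in the ratio. -/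

import Mathlib

open MeasureTheory ProbabilityTheory Filter Set
open scoped Topology ENNReal

/-- The plane of the tabletop, with the Euclidean metric. -/
abbrev TablePlane : Type := EuclideanSpace ℝ (Fin 2)

/-- The unit square `[0,1]²`. -/
def unitSquare : Set TablePlane := {x | ∀ i, x i ∈ Icc (0 : ℝ) 1}

/-- The uniform distribution on the unit square. -/
noncomputable def uniformSquare : Measure TablePlane := volume.restrict unitSquare

/-- An instance with `n` objects: object `i` has start location `(ω i).1` and goal location
`(ω i).2`. -/
abbrev Instance (n : ℕ) : Type := Fin n → TablePlane × TablePlane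

/-- Start locations of the objects of an instance. -/
def Instance.start {n : ℕ} (ω : Instance n) (i : Fin n) : TablePlane := (ω i).1

/-- Goal locations of the objects of an instance. -/
def Instance.goal {n : ℕ} (ω : Instance n) (i : Fin n) : TablePlane := (ω i).2

/-- The `2n` closed discs of radius `ρ` around the starts and the goals are pairwise disjoint
(for `ρ = 0`: the `2n` locations are pairwise distinct). -/
def NonOverlapping {n : ℕ} (ρ : ℝ) (ω : Instance n) : Prop :=
  (∀ i j, i ≠ j → 2 * ρ < dist (ω.start i) (ω.start j)) ∧
  (∀ i j, i ≠ j → 2 * ρ < dist (ω.goal i) (ω.goal j)) ∧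
  (∀ i j, 2 * ρ < dist (ω.start i) (ω.goal j))

/-- The law of a uniformly random non-overlapping instance: `2n` independent uniform points of the
unit square, conditioned on the discs of radius `ρ` around them being pairwise disjoint. -/
noncomputable def randomInstance (n : ℕ) (ρ : ℝ) : Measure (Instance n) :=
  ProbabilityTheory.cond (Measure.pi fun _ : Fin n => uniformSquare.prod uniformSquare)
    {ω | NonOverlapping ρ ω}

/-- Cost of an optimal single-arm solution: pickups and drop-offs of the `n` objects, plus the
start-to-goal transfers, plus the cheapest goal-to-start transits that join the transfers into one
closed loop; `σ` is the order in which the objects are moved. Each pickup together with its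
drop-off costs `cpd`, and each unit of distance costs `ct`. -/
noncomputable def singleArmCost {n : ℕ} (ω : Instance n) (cpd ct : ℝ) : ℝ :=
  n * cpd + ct * ∑ i, dist (ω.start i) (ω.goal i) +
    ct * ⨅ σ : Equiv.Perm (Fin n), ∑ j, dist (ω.goal (σ j)) (ω.start (σ (finRotate n j)))

/-- A collision-free (asynchronous, monotone) solution by two arms, each a disc of radius `r`.
A pickup takes time `cp`, a drop-off takes time `cd`, and moving by one unit of distance takes time
at least `ct`. -/
structure TwoArmPlan {n : ℕ} (ω : Instance n) (cp cd ct r : ℝ) where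
  /-- time at which both arms have finished -/
  makespan : ℝ
  makespan_nonneg : 0 ≤ makespan
  /-- `pos k t` is the position of the centre of arm `k` at time `t` -/
  pos : Fin 2 → ℝ → TablePlane
  /-- the arm that moves the object -/
  arm : Fin n → Fin 2
  /-- time at which the pickup of the object begins -/
  pick : Fin n → ℝ
  /-- time at which the drop-off of the object begins -/
  drop : Fin n → ℝ
  speed : ∀ k, ∀ t ∈ Icc 0 makespan, ∀ u ∈ Icc 0 makespan,
    ct * dist (pos k t) (pos k u) ≤ |t - u|
  /-- each arm makes a closed loop -/
  closed : ∀ k, pos k makespan = pos k 0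
  pick_nonneg : ∀ i, 0 ≤ pick i
  pick_before_drop : ∀ i, pick i + cp ≤ drop i
  drop_before_end : ∀ i, drop i + cd ≤ makespan
  /-- an arm handles one object at a time -/
  one_at_a_time : ∀ i j, i ≠ j → arm i = arm j →
    drop i + cd ≤ pick j ∨ drop j + cd ≤ pick i
  at_start : ∀ i, ∀ t ∈ Icc (pick i) (pick i + cp), pos (arm i) t = ω.start i
  at_goal : ∀ i, ∀ t ∈ Icc (drop i) (drop i + cd), pos (arm i) t = ω.goal i
  /-- the open discs of the two arms are disjoint, except that the arms never obstruct each other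
  while a pickup or a drop-off is being performed -/
  no_collision : ∀ t ∈ Icc 0 makespan,
    (∀ i, t ∉ Icc (pick i) (pick i + cp) ∧ t ∉ Icc (drop i) (drop i + cd)) →
    2 * r ≤ dist (pos 0 t) (pos 1 t)

/-- The mean length (`≈ 0.52`) of a random segment in the unit square, in closed form. -/
noncomputable def meanSegmentLength : ℝ :=
  (2 + Real.sqrt 2 + 5 * Real.log (1 + Real.sqrt 2)) / 15

/-! Write κ for `meanSegmentLength`. The single-arm cost is `n * cpd`, plus the transfer lengths,
plus the transits. The transfer lengths add up to κn + o(n) by concentration. The transits are only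
o(n), because the order may be chosen so that almost every goal lies in the same small grid cell as
the next start. This gives item 1.

For item 3, an arm performs its transfers in disjoint time intervals, so twice any makespan is at
least the single-arm cost without the transits (`TwoArmPlan.sum_transfer_le_two_mul_makespan`).

For item 2, classify each object by its pair of grid cells (start, goal). Objects of type (a, b) and
(b, a) alternate, which makes transits short. The list of types consists of two equal periods, one
for each arm, so the arms, moving in lockstep, always carry objects of the same type. Their
transfers then have nearly equal lengths, and waiting for each other costs almost nothing
(`exists_plan_le`). Collision avoidance delays each lockstep step by at most `16 * r * ct`: each of
the two services costs `4 * r * ct` (`exists_dwell`), and so does each of the two moves, half of it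
from `exists_move` and half from the stand-off positions. With about n/2 steps this is `8 * r * ct`
per object, below 4π`r * ct`.

Both constructions need only that the total transfer length is close to its mean and that no pair of
cells is much rarer than expected. Hoeffding's inequality makes this fail with exponentially small
probability (`exists_typical_rate`). The conditioning event may have probability tending to zero,
but since nρₙ² → 0 it does so more slowly than any exponential
(`eventually_exp_le_iidInstance_nonOverlapping`), so conditioning preserves the estimate. -/

/-! ### Lower bound for every two-arm plan -/

/-- The transfers made by one arm occupy disjoint parts of the time interval of the plan. -/
theorem TwoArmPlan.sum_arm_le_makespan {n : ℕ} {ω : Instance n} {cp cd ct r : ℝ}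
    (hcp : 0 ≤ cp) (hcd : 0 ≤ cd) (P : TwoArmPlan ω cp cd ct r) (k : Fin 2) :
    ∑ i with P.arm i = k, ((cp + cd) + ct * dist (ω.start i) (ω.goal i)) ≤ P.makespan := by
  have hlen : ∀ i, (cp + cd) + ct * dist (ω.start i) (ω.goal i) ≤ P.drop i + cd - P.pick i := by
    intro i
    have h1 := P.pick_nonneg i
    have h2 := P.pick_before_drop i
    have h3 := P.drop_before_end i
    have h4 := P.speed (P.arm i) (P.pick i + cp) ⟨by linarith, by linarith⟩ (P.drop i)
      ⟨by linarith, by linarith⟩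
    rw [P.at_start i _ ⟨by linarith, le_rfl⟩, P.at_goal i _ ⟨le_rfl, by linarith⟩,
      abs_of_nonpos (by linarith)] at h4
    linarith
  set S : Finset (Fin n) := Finset.univ.filter fun i => P.arm i = k with hS
  -- Half-open intervals, since one transfer may begin at the instant the previous one ends.
  have hdisj : Set.PairwiseDisjoint (S : Set (Fin n))
      (fun i => Ico (P.pick i) (P.drop i + cd)) := by
    intro i hi j hj hij
    have hi' : P.arm i = k := by simpa [hS] using hi
    have hj' : P.arm j = k := by simpa [hS] using hj
    refine Set.disjoint_left.2 fun t ht ht' => ?_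
    rcases P.one_at_a_time i j hij (hi'.trans hj'.symm) with h | h
    · exact absurd (h.trans ht'.1) (not_le.2 ht.2)
    · exact absurd (h.trans ht.1) (not_le.2 ht'.2)
  have hvol := measure_biUnion_finset (μ := volume) hdisj (fun i _ => measurableSet_Ico)
  have hsub : (⋃ i ∈ S, Ico (P.pick i) (P.drop i + cd)) ⊆ Ico 0 P.makespan := by
    refine Set.iUnion₂_subset fun i _ => Ico_subset_Ico (P.pick_nonneg i) (P.drop_before_end i)
  have hle := measure_mono (μ := volume) hsub
  rw [hvol] at hle
  simp only [Real.volume_Ico, sub_zero] at hle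
  have hnn : ∀ i ∈ S, 0 ≤ P.drop i + cd - P.pick i := fun i _ => by
    have := P.pick_before_drop i
    linarith
  rw [← ENNReal.ofReal_sum_of_nonneg hnn, ENNReal.ofReal_le_ofReal_iff P.makespan_nonneg] at hle
  exact (Finset.sum_le_sum fun i _ => hlen i).trans hle

theorem TwoArmPlan.sum_transfer_le_two_mul_makespan {n : ℕ} {ω : Instance n} {cp cd ct r : ℝ}
    (hcp : 0 ≤ cp) (hcd : 0 ≤ cd) (P : TwoArmPlan ω cp cd ct r) :
    n * (cp + cd) + ct * ∑ i, dist (ω.start i) (ω.goal i) ≤ 2 * P.makespan := by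
  have h0 := P.sum_arm_le_makespan hcp hcd 0
  have h1 := P.sum_arm_le_makespan hcp hcd 1
  have hsum : ∑ i, ((cp + cd) + ct * dist (ω.start i) (ω.goal i)) =
      ∑ k : Fin 2, ∑ i with P.arm i = k, ((cp + cd) + ct * dist (ω.start i) (ω.goal i)) :=
    (Finset.sum_fiberwise _ _ _).symm
  rw [Finset.sum_add_distrib, ← Finset.mul_sum, Fin.sum_univ_two] at hsum
  simp only [Finset.sum_const, Finset.card_univ, Fintype.card_fin, nsmul_eq_mul] at hsum
  linarith

/-! ### Collision-free motions of two discs -/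

/-- A motion of two arms during `[0, T]` at speed at most `1 / ct`, with centres at distance at
least `2 * r` at all times outside the set `E`. -/
structure ArmMotion (ct r : ℝ) (E : Set ℝ) (T : ℝ) (f : Fin 2 → ℝ → TablePlane) : Prop where
  nonneg : 0 ≤ T
  speed : ∀ k, ∀ t ∈ Icc 0 T, ∀ u ∈ Icc 0 T, ct * dist (f k t) (f k u) ≤ |t - u|
  sep : ∀ t ∈ Icc 0 T, t ∉ E → 2 * r ≤ dist (f 0 t) (f 1 t)

/-- Follow `f` until time `T`, then `g`. -/
noncomputable def armGlue (T : ℝ) (f g : Fin 2 → ℝ → TablePlane) (k : Fin 2) (t : ℝ) :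
    TablePlane :=
  if t ≤ T then f k t else g k (t - T)

theorem armGlue_of_le {T t : ℝ} (f g : Fin 2 → ℝ → TablePlane) (k : Fin 2) (h : t ≤ T) :
    armGlue T f g k t = f k t := if_pos h

theorem armGlue_of_ge {T t : ℝ} {f g : Fin 2 → ℝ → TablePlane} (hfg : ∀ k, f k T = g k 0)
    (k : Fin 2) (h : T ≤ t) : armGlue T f g k t = g k (t - T) := by
  rcases h.eq_or_lt with rfl | h
  · simp [armGlue, hfg]
  · exact if_neg (not_le.2 h)

theorem ArmMotion.glue {ct r T T' : ℝ} {E E' E'' : Set ℝ} {f g : Fin 2 → ℝ → TablePlane}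
    (hct : 0 ≤ ct) (hf : ArmMotion ct r E T f) (hg : ArmMotion ct r E' T' g)
    (hfg : ∀ k, f k T = g k 0)
    (hE : E ⊆ E'') (hE' : ∀ t ∈ E', T + t ∈ E'') :
    ArmMotion ct r E'' (T + T') (armGlue T f g) := by
  have hT := hf.nonneg
  have hT' := hg.nonneg
  have key : ∀ k, ∀ t ∈ Icc 0 (T + T'), ∀ u ∈ Icc 0 (T + T'), t ≤ u →
      ct * dist (armGlue T f g k t) (armGlue T f g k u) ≤ u - t := by
    intro k t ht u hu htu
    rcases le_total u T with huT | huT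
    · rw [armGlue_of_le _ _ _ huT, armGlue_of_le _ _ _ (htu.trans huT)]
      have := hf.speed k t ⟨ht.1, htu.trans huT⟩ u ⟨hu.1, huT⟩
      rwa [abs_of_nonpos (by linarith), neg_sub] at this
    · rcases le_total t T with htT | htT
      · rw [armGlue_of_le _ _ _ htT, armGlue_of_ge hfg _ huT]
        have h1 := hf.speed k t ⟨ht.1, htT⟩ T ⟨hT, le_rfl⟩
        have h2 := hg.speed k 0 ⟨le_rfl, hT'⟩ (u - T) ⟨by linarith, by linarith [hu.2]⟩
        rw [abs_of_nonpos (by linarith)] at h1 h2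
        rw [← hfg] at h2
        have h3 := mul_le_mul_of_nonneg_left (dist_triangle (f k t) (f k T) (g k (u - T))) hct
        linarith
      · rw [armGlue_of_ge hfg _ htT, armGlue_of_ge hfg _ huT]
        have := hg.speed k (t - T) ⟨by linarith, by linarith [ht.2]⟩ (u - T)
          ⟨by linarith, by linarith [hu.2]⟩
        rwa [abs_of_nonpos (by linarith), neg_sub, sub_sub_sub_cancel_right] at this
  refine ⟨by linarith, fun k t ht u hu => ?_, fun t ht htE => ?_⟩
  · rcases le_total t u with h | h
    · rw [abs_sub_comm, abs_of_nonneg (sub_nonneg.2 h)]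
      exact key k t ht u hu h
    · rw [abs_of_nonneg (sub_nonneg.2 h), dist_comm]
      exact key k u hu t ht h
  · rcases le_total t T with h | h
    · rw [armGlue_of_le _ _ _ h, armGlue_of_le _ _ _ h]
      exact hf.sep t ⟨ht.1, h⟩ fun h' => htE (hE h')
    · rw [armGlue_of_ge hfg _ h, armGlue_of_ge hfg _ h]
      refine hg.sep _ ⟨by linarith, by linarith [ht.2]⟩ fun h' => htE ?_
      simpa using hE' _ h'

/-- Uniform linear motion of both arms. -/
theorem exists_linear_motion {ct r L : ℝ} (hct : 0 < ct) (hL : 0 ≤ L) (p q : Fin 2 → TablePlane)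
    (hpq : ∀ k, ct * dist (p k) (q k) ≤ L)
    (hsep : ∀ s ∈ Icc (0 : ℝ) 1, 2 * r ≤ ‖AffineMap.lineMap (k := ℝ) (p 0 - p 1) (q 0 - q 1) s‖) :
    ∃ f, ArmMotion ct r ∅ L f ∧ (∀ k, f k 0 = p k) ∧ ∀ k, f k L = q k := by
  refine ⟨fun k t => AffineMap.lineMap (p k) (q k) (t / L), ⟨hL, ?_, ?_⟩, ?_, ?_⟩
  · intro k t ht u hu
    rw [dist_lineMap_lineMap, Real.dist_eq, ← sub_div, abs_div, abs_of_nonneg hL]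
    rcases hL.eq_or_lt with h | h
    · simp [← h]
    · calc ct * (|t - u| / L * dist (p k) (q k)) = |t - u| * (ct * dist (p k) (q k) / L) := by
            ring
        _ ≤ |t - u| * 1 := by
            gcongr
            exact (div_le_one h).2 (hpq k)
        _ = _ := mul_one _
  · intro t ht _
    have := hsep (t / L) ⟨div_nonneg ht.1 hL, div_le_one_of_le₀ ht.2 hL⟩
    have heq : AffineMap.lineMap (p 0) (q 0) (t / L) - AffineMap.lineMap (p 1) (q 1) (t / L) =
        AffineMap.lineMap (k := ℝ) (p 0 - p 1) (q 0 - q 1) (t / L) := by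
      simp only [AffineMap.lineMap_apply_module]
      module
    rwa [dist_eq_norm, heq]
  · intro k
    simp
  · intro k
    -- If `L = 0` then `t / L` is `0` and the path never leaves `p k`; the speed bound forces `p k =
    -- q k`.
    rcases hL.eq_or_lt with h | h
    · have h1 := hpq k
      rw [← h] at h1
      have h2 : dist (p k) (q k) = 0 := by
        have := dist_nonneg (x := p k) (y := q k)
        nlinarith
      simp [dist_eq_zero.1 h2]
    · simp [h.ne']

theorem exists_unit_inner_eq_zero (w : TablePlane) :
    ∃ u : TablePlane, ‖u‖ = 1 ∧ inner ℝ w u = 0 := by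
  have hv : ∃ v : TablePlane, v ≠ 0 ∧ inner ℝ w v = 0 := by
    by_cases hw : w = 0
    · exact ⟨EuclideanSpace.single 0 1, by simp, by simp [hw]⟩
    · refine ⟨!₂[-w 1, w 0], fun h => hw ?_, ?_⟩
      · have h0 := congrArg (fun x : TablePlane => x 0) h
        have h1 := congrArg (fun x : TablePlane => x 1) h
        simp at h0 h1
        ext i
        fin_cases i <;> simp [h0, h1]
      · simp [PiLp.inner_apply, Fin.sum_univ_two]
        ring
  obtain ⟨v, hv0, hv⟩ := hv
  refine ⟨(‖v‖⁻¹ : ℝ) • v, norm_smul_inv_norm hv0, ?_⟩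
  rw [inner_smul_right, hv, mul_zero]

/-- Two arms that are apart can move to any two positions that are apart, with a delay of
`2 * r * ct` for avoiding each other. -/
theorem exists_move {ct r : ℝ} (hct : 0 < ct) (hr : 0 ≤ r) (p q : Fin 2 → TablePlane)
    (hp : 2 * r ≤ dist (p 0) (p 1)) (hq : 2 * r ≤ dist (q 0) (q 1)) {l : ℝ} (hl : 0 ≤ l)
    (hpq : ∀ k, dist (p k) (q k) ≤ l) :
    ∃ f, ArmMotion ct r ∅ (ct * (l + 2 * r)) f ∧ (∀ k, f k 0 = p k) ∧
      ∀ k, f k (ct * (l + 2 * r)) = q k := by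
  -- Take `u` orthogonal to the change of the relative position of the arms. Its component along `u`
  -- is then the same at both ends, and the sign of `u` makes it nonnegative. The arms first move
  -- apart by `r` each along `±u`, then travel straight, then undo the shift.
  obtain ⟨u, hu1, hu2, hu3⟩ : ∃ u : TablePlane, ‖u‖ = 1 ∧
      inner ℝ ((q 0 - q 1) - (p 0 - p 1)) u = 0 ∧ 0 ≤ inner ℝ (p 0 - p 1) u := by
    obtain ⟨u, h1, h2⟩ := exists_unit_inner_eq_zero ((q 0 - q 1) - (p 0 - p 1))
    rcases le_total 0 (inner ℝ (p 0 - p 1) u) with h | h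
    · exact ⟨u, h1, h2, h⟩
    · exact ⟨-u, by simpa, by simpa using h2, by simpa using h⟩
  rw [dist_eq_norm] at hp hq
  set d := p 0 - p 1 with hd
  set d' := q 0 - q 1 with hd'
  have hu4 : 0 ≤ inner ℝ d' u := by
    rw [inner_sub_left] at hu2
    linarith
  set σ : Fin 2 → ℝ := ![1, -1] with hσ
  have hσabs : ∀ k, |σ k| = 1 := by
    intro k
    fin_cases k <;> simp [hσ]
  let p' : Fin 2 → TablePlane := fun k => p k + (σ k * r) • u
  let q' : Fin 2 → TablePlane := fun k => q k + (σ k * r) • u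
  have hpd : p' 0 - p' 1 = d + (2 * r) • u := by
    simp only [p', hσ, hd, Matrix.cons_val_zero, Matrix.cons_val_one]
    module
  have hqd : q' 0 - q' 1 = d' + (2 * r) • u := by
    simp only [q', hσ, hd', Matrix.cons_val_zero, Matrix.cons_val_one]
    module
  have hshift : ∀ v : TablePlane, 2 * r ≤ ‖v‖ → 0 ≤ inner ℝ v u → ∀ s, 0 ≤ s →
      2 * r ≤ ‖v + (s * (2 * r)) • u‖ := by
    intro v hv hvu s hs
    refine hv.trans ?_
    rw [← sq_le_sq₀ (norm_nonneg _) (norm_nonneg _), norm_add_sq_real, inner_smul_right]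
    have : 0 ≤ s * (2 * r) * inner ℝ v u := by positivity
    nlinarith [sq_nonneg ‖(s * (2 * r)) • u‖]
  have hdist : ∀ (x : TablePlane) k, ct * dist x (x + (σ k * r) • u) ≤ ct * r := by
    intro x k
    rw [dist_self_add_right, norm_smul, hu1, mul_one, Real.norm_eq_abs, abs_mul, hσabs, one_mul,
      abs_of_nonneg hr]
  have hctr : 0 ≤ ct * r := by positivity
  have hctl : 0 ≤ ct * l := by positivity
  obtain ⟨f₁, hf₁, hf₁0, hf₁1⟩ := exists_linear_motion (r := r) hct hctr p p'
    (fun k => hdist _ _) (fun s hs => by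
      convert hshift d hp hu3 s hs.1 using 2
      rw [hpd, ← hd, AffineMap.lineMap_apply_module]
      module)
  obtain ⟨f₂, hf₂, hf₂0, hf₂1⟩ := exists_linear_motion (r := r) hct hctl p' q'
    (fun k => by
      simp only [p', q', dist_add_right]
      exact mul_le_mul_of_nonneg_left (hpq k) hct.le) (fun s hs => by
      -- During the straight travel the component along `u` alone keeps the arms apart: the shift
      -- contributes `2 * r` to it and the rest is nonnegative.
      have h1 : 2 * r ≤ inner ℝ (AffineMap.lineMap (p' 0 - p' 1) (q' 0 - q' 1) s) u := by
        rw [hpd, hqd, AffineMap.lineMap_apply_module, inner_add_left, inner_smul_left,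
          inner_smul_left, inner_add_left, inner_add_left, inner_smul_left, real_inner_self_eq_norm_sq,
          hu1]
        simp only [conj_trivial]
        have := mul_nonneg (sub_nonneg.2 hs.2) hu3
        have := mul_nonneg hs.1 hu4
        linarith
      refine h1.trans ((real_inner_le_norm _ _).trans ?_)
      rw [hu1, mul_one])
  obtain ⟨f₃, hf₃, hf₃0, hf₃1⟩ := exists_linear_motion (r := r) hct hctr q' q
    (fun k => by rw [dist_comm]; exact hdist _ _) (fun s hs => by
      convert hshift d' hq hu4 (1 - s) (sub_nonneg.2 hs.2) using 2
      rw [hqd, ← hd', AffineMap.lineMap_apply_module]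
      module)
  have hg := hf₁.glue hct.le hf₂ (fun k => by rw [hf₁1, hf₂0]) subset_rfl (E'' := ∅) (by simp)
  have hend : ∀ k, armGlue (ct * r) f₁ f₂ k (ct * r + ct * l) = q' k := by
    intro k
    rw [armGlue_of_ge (fun k => by rw [hf₁1, hf₂0]) _ (by linarith), add_sub_cancel_left, hf₂1]
  have hg' := hg.glue hct.le hf₃ (fun k => by rw [hend, hf₃0]) subset_rfl (E'' := ∅) (by simp)
  have hT : ct * (l + 2 * r) = ct * r + ct * l + ct * r := by ring
  rw [hT]
  refine ⟨_, hg', fun k => ?_, fun k => ?_⟩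
  · rw [armGlue_of_le _ _ _ (by linarith), armGlue_of_le _ _ _ hctr, hf₁0]
  · rw [armGlue_of_ge (fun k => by rw [hend, hf₃0]) _ (by linarith), add_sub_cancel_left, hf₃1]

/-- A unit vector pointing from `y` to `x` (any unit vector if `x = y`). -/
theorem exists_direction (x y : TablePlane) :
    ∃ e : TablePlane, ‖e‖ = 1 ∧ x - y = dist x y • e := by
  by_cases h : x = y
  · exact ⟨EuclideanSpace.single 0 1, by simp, by simp [h]⟩
  · have h' : x - y ≠ 0 := sub_ne_zero.2 h
    refine ⟨(‖x - y‖⁻¹ : ℝ) • (x - y), norm_smul_inv_norm h', ?_⟩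
    rw [dist_eq_norm, smul_smul, mul_inv_cancel₀ (norm_ne_zero_iff.2 h'), one_smul]

noncomputable def armDir (x y : TablePlane) : TablePlane := (exists_direction x y).choose

theorem norm_armDir (x y : TablePlane) : ‖armDir x y‖ = 1 := (exists_direction x y).choose_spec.1

theorem sub_eq_armDir (x y : TablePlane) : x - y = dist x y • armDir x y :=
  (exists_direction x y).choose_spec.2

/-- Positions from which two arms can start serving the points `z 0` and `z 1`. -/
noncomputable def approach (r : ℝ) (z : Fin 2 → TablePlane) : Fin 2 → TablePlane :=
  ![z 0, z 1 - (2 * r) • armDir (z 0) (z 1)]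

/-- Positions in which two arms are left after serving the points `z 0` and `z 1`. -/
noncomputable def depart (r : ℝ) (z : Fin 2 → TablePlane) : Fin 2 → TablePlane :=
  ![z 0 + (2 * r) • armDir (z 0) (z 1), z 1]

/-- Both displacements point away from the other point along the joining line, so they add to the
distance. With either one equal to `2 * r` the arms are safe, even if the points coincide. -/
theorem dist_add_smul_armDir {a b : ℝ} (x y : TablePlane) (ha : 0 ≤ a) (hb : 0 ≤ b) :
    dist (x + a • armDir x y) (y - b • armDir x y) = dist x y + a + b := by
  have h : x + a • armDir x y - (y - b • armDir x y) = (dist x y + a + b) • armDir x y := by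
    rw [add_smul, add_smul, ← sub_eq_armDir]
    abel
  rw [dist_eq_norm, h, norm_smul, norm_armDir, mul_one, Real.norm_of_nonneg]
  have := dist_nonneg (x := x) (y := y)
  positivity

theorem two_mul_le_dist_approach {r : ℝ} (hr : 0 ≤ r) (z : Fin 2 → TablePlane) :
    2 * r ≤ dist (approach r z 0) (approach r z 1) := by
  have := dist_add_smul_armDir (a := 0) (b := 2 * r) (z 0) (z 1) le_rfl (by positivity)
  rw [zero_smul, add_zero] at this
  simp only [approach, Matrix.cons_val_zero, Matrix.cons_val_one]
  rw [this]
  have := dist_nonneg (x := z 0) (y := z 1)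
  linarith

theorem two_mul_le_dist_depart {r : ℝ} (hr : 0 ≤ r) (z : Fin 2 → TablePlane) :
    2 * r ≤ dist (depart r z 0) (depart r z 1) := by
  have := dist_add_smul_armDir (a := 2 * r) (b := 0) (z 0) (z 1) (by positivity) le_rfl
  rw [zero_smul, sub_zero] at this
  simp only [depart, Matrix.cons_val_zero, Matrix.cons_val_one]
  rw [this]
  have := dist_nonneg (x := z 0) (y := z 1)
  linarith

theorem dist_depart_approach_le {r : ℝ} (hr : 0 ≤ r) (z w : Fin 2 → TablePlane) (k : Fin 2) :
    dist (depart r z k) (approach r w k) ≤ dist (z k) (w k) + 2 * r := by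
  have h : ∀ x y, ‖(2 * r) • armDir x y‖ = 2 * r := fun x y => by
    rw [norm_smul, norm_armDir, mul_one, Real.norm_of_nonneg (by positivity)]
  fin_cases k
  · simp only [depart, approach, Fin.zero_eta, Matrix.cons_val_zero]
    refine (dist_triangle _ (z 0) _).trans ?_
    rw [dist_self_add_left, h]
    linarith
  · change dist (z 1) (w 1 - (2 * r) • armDir (w 0) (w 1)) ≤ dist (z 1) (w 1) + 2 * r
    refine (dist_triangle _ (w 1) _).trans ?_
    rw [dist_self_sub_right, h]

theorem mul_abs_clamp_sub_clamp_le {ct m : ℝ} (hct : 0 < ct) (t u : ℝ) :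
    ct * |min m (max 0 (t / ct)) - min m (max 0 (u / ct))| ≤ |t - u| := by
  have h1 : |min m (max 0 (t / ct)) - min m (max 0 (u / ct))| ≤ |t / ct - u / ct| := by
    refine (abs_min_sub_min_le_max _ _ _ _).trans ?_
    rw [sub_self, abs_zero]
    refine max_le (abs_nonneg _) ?_
    refine (abs_max_sub_max_le_max _ _ _ _).trans ?_
    rw [sub_self, abs_zero]
    exact max_le (abs_nonneg _) le_rfl
  calc _ ≤ ct * |t / ct - u / ct| := by gcongr
    _ = |t - u| := by
      rw [← sub_div, abs_div, abs_of_pos hct, mul_div_cancel₀ _ hct.ne']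

/-- Two arms can serve any two points for a time `c` each, with a delay of `4 * r * ct`. -/
theorem exists_dwell {ct r c : ℝ} (hct : 0 < ct) (hr : 0 ≤ r) (hc : 0 ≤ c)
    (z : Fin 2 → TablePlane) :
    ∃ (T : ℝ) (f : Fin 2 → ℝ → TablePlane) (τ : Fin 2 → ℝ), T ≤ c + 4 * r * ct ∧
      ArmMotion ct r {t | ∃ a, t ∈ Icc (τ a) (τ a + c) ∧ dist (z 0) (z 1) < 2 * r} T f ∧
      (∀ a, f a 0 = approach r z a) ∧ (∀ a, f a T = depart r z a) ∧
      ∀ a, 0 ≤ τ a ∧ τ a + c ≤ T ∧ ∀ t ∈ Icc (τ a) (τ a + c), f a t = z a := by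
  set s := 2 * r * ct with hs
  have hs0 : 0 ≤ s := by positivity
  -- Here `s` is the time to cover `2 * r`, and `δ` is when the second arm starts to come in. If `s
  -- ≤ c` it comes in at once: its service begins before the first one ends, so services cover the
  -- whole interval and no collision counts. Otherwise it comes in exactly while the first arm backs
  -- off, and the two displacements always add up to `2 * r`. Either way the delay is `δ + s ≤ 2 *
  -- s`.
  obtain ⟨δ, hδ0, hδs, hδ⟩ : ∃ δ, 0 ≤ δ ∧ δ ≤ s ∧ (δ = c ∨ δ = 0 ∧ s ≤ c) := by
    rcases le_total s c with h | h
    · exact ⟨0, le_rfl, hs0, Or.inr ⟨rfl, h⟩⟩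
    · exact ⟨c, hc, h, Or.inl rfl⟩
  set e := armDir (z 0) (z 1) with he
  have he1 : ‖e‖ = 1 := norm_armDir _ _
  -- A ramp from `0` to `2 * r` at full speed `1 / ct`.
  set φ : ℝ → ℝ := fun t => min (2 * r) (max 0 (t / ct)) with hφ
  have hφlip : ∀ t u, ct * |φ t - φ u| ≤ |t - u| := mul_abs_clamp_sub_clamp_le hct
  have hφ0 : ∀ t, t ≤ 0 → φ t = 0 := by
    intro t ht
    have : t / ct ≤ 0 := div_nonpos_of_nonpos_of_nonneg ht hct.le
    simp only [hφ, max_eq_left this]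
    exact min_eq_right (by positivity)
  have hφ1 : ∀ t, s ≤ t → φ t = 2 * r := by
    intro t ht
    have : 2 * r ≤ t / ct := (le_div_iff₀ hct).2 ht
    exact min_eq_left (this.trans (le_max_right _ _))
  have hφnn : ∀ t, 0 ≤ φ t := fun t => le_min (by positivity) (le_max_left _ _)
  have hφle : ∀ t, φ t ≤ 2 * r := fun t => min_le_left _ _
  refine ⟨δ + s + c, ![fun t => z 0 + φ (t - c) • e, fun t => z 1 - (2 * r - φ (t - δ)) • e],
    ![0, δ + s], by linarith, ⟨by linarith, ?_, ?_⟩, ?_, ?_, ?_⟩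
  · intro k t _ u _
    fin_cases k
    · simp only [Fin.zero_eta, Matrix.cons_val_zero]
      rw [dist_add_left, dist_eq_norm, ← sub_smul, norm_smul, he1, mul_one, Real.norm_eq_abs]
      simpa using hφlip (t - c) (u - c)
    · change ct * dist (z 1 - (2 * r - φ (t - δ)) • e) (z 1 - (2 * r - φ (u - δ)) • e) ≤ |t - u|
      rw [dist_sub_left, dist_eq_norm, ← sub_smul, norm_smul, he1, mul_one, Real.norm_eq_abs]
      have := hφlip (u - δ) (t - δ)
      rw [sub_sub_sub_cancel_right] at this
      rwa [sub_sub_sub_cancel_left, abs_sub_comm t u]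
  · intro t ht htE
    simp only [Matrix.cons_val_zero, Matrix.cons_val_one]
    rw [he, dist_add_smul_armDir _ _ (hφnn _) (by linarith [hφle (t - δ)])]
    by_cases hd : dist (z 0) (z 1) < 2 * r
    · rcases hδ with rfl | ⟨rfl, hsc⟩
      · have := dist_nonneg (x := z 0) (y := z 1)
        linarith
      · exfalso
        apply htE
        rcases le_total t c with h | h
        · exact ⟨0, by simpa using ⟨ht.1, h⟩, hd⟩
        · exact ⟨1, by simpa using ⟨hsc.trans h, by linarith [ht.2]⟩, hd⟩
    · have h1 := hφnn (t - c)
      have h2 := hφle (t - δ)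
      linarith [not_lt.1 hd]
  · intro a
    fin_cases a
    · simp [approach, hφ0 (-c) (by linarith)]
    · simp [approach, hφ0 (-δ) (by linarith), he]
  · intro a
    fin_cases a
    · have : φ (δ + s) = 2 * r := hφ1 _ (by linarith)
      simp [depart, this, he]
    · have : φ (δ + s + c - δ) = 2 * r := hφ1 _ (by linarith)
      simp [depart, this]
  · intro a
    fin_cases a
    · refine ⟨le_rfl, by simp; linarith, fun t ht => ?_⟩
      have h : t ≤ c := by simpa using ht.2
      simp [hφ0 (t - c) (by linarith)]
    · refine ⟨by simp; linarith, by simp, fun t ht => ?_⟩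
      have h : δ + s ≤ t := by simpa using ht.1
      simp [hφ1 (t - δ) (by linarith)]

/-- Two arms can serve two sequences of points in lockstep. -/
theorem exists_schedule {ct r : ℝ} (hct : 0 < ct) (hr : 0 ≤ r) (X : ℕ → Fin 2 → TablePlane)
    (c : ℕ → ℝ) (hc : ∀ k, 0 ≤ c k) (l : ℕ → ℝ) (K : ℕ)
    (hl : ∀ k < K, ∀ a, dist (X k a) (X (k + 1) a) ≤ l k) :
    ∃ (T : ℝ) (f : Fin 2 → ℝ → TablePlane) (τ : ℕ → Fin 2 → ℝ),
      ArmMotion ct r {t | ∃ k < K, ∃ a, t ∈ Icc (τ k a) (τ k a + c k) ∧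
        dist (X k 0) (X k 1) < 2 * r} T f ∧
      (∀ a, f a 0 = approach r (X 0) a) ∧ (∀ a, f a T = approach r (X K) a) ∧
      T ≤ ∑ k ∈ Finset.range K, (c k + ct * (l k + 8 * r)) ∧
      (∀ k < K, ∀ a, 0 ≤ τ k a ∧ τ k a + c k ≤ T ∧
        ∀ t ∈ Icc (τ k a) (τ k a + c k), f a t = X k a) ∧
      ∀ j k, j < k → k < K → ∀ a, τ j a + c j ≤ τ k a := by
  induction K with
  | zero =>
    refine ⟨0, fun a _ => approach r (X 0) a, fun _ _ => 0, ⟨le_rfl, fun k t _ u _ => by simp,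
      fun t _ _ => two_mul_le_dist_approach hr _⟩, fun _ => rfl, fun _ => rfl, by simp, by simp,
      by simp⟩
  | succ K ih =>
    obtain ⟨T, f, τ, hf, hf0, hf1, hT, hτ, hord⟩ := ih fun k hk => hl k (hk.trans (Nat.lt_succ_self K))
    replace hl := hl K (Nat.lt_succ_self K)
    obtain ⟨T', f', τ', hT', hf', hf'0, hf'1, hτ'⟩ := exists_dwell hct hr (hc K) (X K)
    have hlK : 0 ≤ l K + 2 * r := by
      have := (dist_nonneg).trans (hl 0)
      positivity
    -- Stopping at the next approach position, not at the next point, keeps the arms apart between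
    -- services and lets a cyclic sequence close up.
    obtain ⟨g, hg, hg0, hg1⟩ := exists_move hct hr (depart r (X K)) (approach r (X (K + 1)))
      (two_mul_le_dist_depart hr _) (two_mul_le_dist_approach hr _) hlK
      (fun a => (dist_depart_approach_le hr _ _ a).trans (by linarith [hl a]))
    have hff' : ∀ a, f a T = f' a 0 := fun a => by rw [hf1, hf'0]
    set τ₂ : ℕ → Fin 2 → ℝ := fun k a => if k < K then τ k a else T + τ' a with hτ₂
    have hlt : ∀ k, k < K → τ₂ k = τ k := fun k h => by
      funext a
      simp [hτ₂, h]
    have hK : ∀ a, τ₂ K a = T + τ' a := fun a => by simp [hτ₂]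
    have hT0 := hf.nonneg
    have hT'0 := hf'.nonneg
    have hm := hf.glue hct.le hf' hff' (E'' := {t | ∃ k < K + 1, ∃ a,
      t ∈ Icc (τ₂ k a) (τ₂ k a + c k) ∧ dist (X k 0) (X k 1) < 2 * r}) (by
        rintro t ⟨k, hk, a, h⟩
        exact ⟨k, hk.trans (Nat.lt_succ_self K), a, by rwa [hlt k hk]⟩) (by
        rintro t ⟨a, h, h'⟩
        refine ⟨K, Nat.lt_succ_self K, a, ?_, h'⟩
        rw [hK]
        exact ⟨by linarith [h.1], by linarith [h.2]⟩)
    have hend : ∀ a, armGlue T f f' a (T + T') = depart r (X K) a := fun a => by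
      rw [armGlue_of_ge hff' _ (by linarith), add_sub_cancel_left, hf'1]
    have hglue : ∀ a, armGlue T f f' a (T + T') = g a 0 := fun a => by rw [hend, hg0]
    have hm' := hm.glue hct.le hg hglue subset_rfl (by simp)
    have hbefore : ∀ {a t}, t ≤ T →
        armGlue (T + T') (armGlue T f f') g a t = f a t := fun h => by
      rw [armGlue_of_le _ _ _ (by linarith), armGlue_of_le _ _ _ h]
    have hmove : 0 ≤ ct * (l K + 2 * r + 2 * r) := by positivity
    refine ⟨_, _, τ₂, hm', fun a => ?_, fun a => ?_, ?_, ?_, ?_⟩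
    · rw [hbefore hT0, hf0]
    · rw [armGlue_of_ge hglue _ (by linarith), add_sub_cancel_left, hg1]
    · rw [Finset.sum_range_succ]
      nlinarith
    · intro k hk a
      rcases (Nat.lt_succ_iff_lt_or_eq.1 hk) with h | rfl
      · rw [hlt k h]
        obtain ⟨h1, h2, h3⟩ := hτ k h a
        refine ⟨h1, by linarith, fun t ht => ?_⟩
        rw [hbefore (by linarith [ht.2]), h3 t ht]
      · rw [hK]
        obtain ⟨h1, h2, h3⟩ := hτ' a
        refine ⟨by linarith, by linarith, fun t ht => ?_⟩
        rw [armGlue_of_le _ _ _ (by linarith [ht.2]), armGlue_of_ge hff' _ (by linarith [ht.1]),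
          h3 _ ⟨by linarith [ht.1], by linarith [ht.2]⟩]
    · intro j k hjk hk a
      rcases (Nat.lt_succ_iff_lt_or_eq.1 hk) with h | rfl
      · rw [hlt k h, hlt j (hjk.trans h)]
        exact hord j k hjk h a
      · rw [hK, hlt j hjk]
        linarith [(hτ j hjk a).2.1, (hτ' a).1]

theorem sum_range_two_mul (F : ℕ → ℝ) (h : ℕ) :
    ∑ k ∈ Finset.range (2 * h), F k = ∑ j ∈ Finset.range h, (F (2 * j) + F (2 * j + 1)) := by
  induction h with
  | zero => simp
  | succ h ih =>
    rw [show 2 * (h + 1) = 2 * h + 1 + 1 by ring, Finset.sum_range_succ, Finset.sum_range_succ, ih,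
      Finset.sum_range_succ]
    ring

/-- A two-arm plan in which the arms serve the objects in lockstep: in step `j`, arm `a` travels
through `A j a` and `B j a`, which are the start and the goal of the object it moves in this step,
if there is one. -/
theorem exists_lockstep_plan {n : ℕ} {ω : Instance n} {cp cd ct r : ℝ} (hcp : 0 ≤ cp)
    (hcd : 0 ≤ cd) (hct : 0 < ct) (hr : 0 ≤ r) (h : ℕ) (step : Fin n → ℕ) (arm : Fin n → Fin 2)
    (hinj : ∀ i j, step i = step j → arm i = arm j → i = j) (hstep : ∀ i, step i < h)
    (A B : ℕ → Fin 2 → TablePlane) (hA : ∀ i, A (step i) (arm i) = ω.start i)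
    (hB : ∀ i, B (step i) (arm i) = ω.goal i) (hloop : A h = A 0)
    (hfree : ∀ j < h, (∀ a, ∃ i, step i = j ∧ arm i = a) ∨
      2 * r ≤ dist (A j 0) (A j 1) ∧ 2 * r ≤ dist (B j 0) (B j 1))
    (l l' : ℕ → ℝ) (hl : ∀ j < h, ∀ a, dist (A j a) (B j a) ≤ l j)
    (hl' : ∀ j < h, ∀ a, dist (B j a) (A (j + 1) a) ≤ l' j) :
    ∃ P : TwoArmPlan ω cp cd ct r,
      P.makespan ≤ ∑ j ∈ Finset.range h, (cp + cd + ct * (l j + l' j + 16 * r)) := by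
  set X : ℕ → Fin 2 → TablePlane := fun k => if k % 2 = 0 then A (k / 2) else B (k / 2) with hX
  have hX0 : ∀ j, X (2 * j) = A j := fun j => by simp [hX]
  have hX1 : ∀ j, X (2 * j + 1) = B j := fun j => by
    simp only [hX]
    rw [if_neg (by omega), show (2 * j + 1) / 2 = j by omega]
  set c : ℕ → ℝ := fun k => if k % 2 = 0 then cp else cd with hc
  have hc0 : ∀ j, c (2 * j) = cp := fun j => by simp [hc]
  have hc1 : ∀ j, c (2 * j + 1) = cd := fun j => by
    simp only [hc]
    rw [if_neg (by omega)]
  set L : ℕ → ℝ := fun k => if k % 2 = 0 then l (k / 2) else l' (k / 2) with hL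
  have hL0 : ∀ j, L (2 * j) = l j := fun j => by simp [hL]
  have hL1 : ∀ j, L (2 * j + 1) = l' j := fun j => by
    simp only [hL]
    rw [if_neg (by omega), show (2 * j + 1) / 2 = j by omega]
  obtain ⟨T, f, τ, hf, hf0, hf1, hT, hτ, hord⟩ := exists_schedule hct hr X c
    (fun k => by simp only [hc]; split_ifs <;> assumption) L (2 * h) (fun k hk a => by
      obtain ⟨j, rfl | rfl⟩ := k.even_or_odd'
      · rw [hX0, hX1, hL0]
        exact hl j (by omega) a
      · rw [hX1, show 2 * j + 1 + 1 = 2 * (j + 1) by ring, hX0, hL1]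
        exact hl' j (by omega) a)
  have e0 : ∀ i, 2 * step i < 2 * h := fun i => by have := hstep i; omega
  have e1 : ∀ i, 2 * step i + 1 < 2 * h := fun i => by have := hstep i; omega
  have a0 := fun i => hτ _ (e0 i) (arm i)
  have a1 := fun i => hτ _ (e1 i) (arm i)
  simp only [hc0, hX0, hA] at a0
  simp only [hc1, hX1, hB] at a1
  have hseq : ∀ i j, step i < step j → arm i = arm j →
      τ (2 * step i + 1) (arm i) + cd ≤ τ (2 * step j) (arm j) := by
    intro i j hij harm
    have := hord (2 * step i + 1) (2 * step j) (by omega) (e0 j) (arm i)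
    rw [hc1] at this
    rwa [← harm]
  refine ⟨⟨T, hf.nonneg, f, arm, fun i => τ (2 * step i) (arm i),
    fun i => τ (2 * step i + 1) (arm i), hf.speed, fun k => ?_, fun i => (a0 i).1, fun i => ?_,
    fun i => (a1 i).2.1, fun i j hij harm => ?_, fun i => (a0 i).2.2, fun i => (a1 i).2.2,
    fun t ht hfr => ?_⟩, hT.trans ?_⟩
  · rw [hf1, hf0, hX0, hloop, ← hX0 0]
  · have := hord (2 * step i) (2 * step i + 1) (by omega) (e1 i) (arm i)
    rwa [hc0] at this
  · rcases lt_trichotomy (step i) (step j) with h | h | h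
    · exact Or.inl (hseq i j h harm)
    · exact absurd (hinj i j h harm) hij
    · exact Or.inr (hseq j i h harm.symm)
  · refine hf.sep t ht ?_
    rintro ⟨k, hk, a, hta, hd⟩
    obtain ⟨j, rfl | rfl⟩ := k.even_or_odd'
    · rw [hX0] at hd
      -- The exempt times of the schedule are genuine pickups only if both arms have an object in
      -- this step. Otherwise the two points are far apart and no exemption was used.
      rcases hfree j (by omega) with h' | h'
      · obtain ⟨i, rfl, rfl⟩ := h' a
        rw [hc0] at hta
        exact (hfr i).1 hta
      · exact absurd hd (not_lt.2 h'.1)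
    · rw [hX1] at hd
      rcases hfree j (by omega) with h' | h'
      · obtain ⟨i, rfl, rfl⟩ := h' a
        rw [hc1] at hta
        exact (hfr i).2 hta
      · exact absurd hd (not_lt.2 h'.2)
  · rw [sum_range_two_mul]
    refine (Finset.sum_congr rfl fun j _ => ?_).le
    rw [hc0, hc1, hL0, hL1]
    ring

/-! ### Ordering the objects by pairs of cells -/

/-- Embed each fibre of `f` into the corresponding fibre of `g` and glue. It serves to fill a
prescribed sequence of types with distinct objects. -/
theorem exists_injective_comp_eq {α β γ : Type*} [Fintype α] [Fintype β] [DecidableEq γ]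
    (f : α → γ) (g : β → γ)
    (h : ∀ a, Fintype.card {x // f x = f a} ≤ Fintype.card {y // g y = f a}) :
    ∃ e : α → β, Function.Injective e ∧ ∀ a, g (e a) = f a := by
  have hE : ∀ t, Nonempty ({x // f x = t} ↪ {y // g y = t}) := by
    intro t
    by_cases ht : ∃ a, f a = t
    · obtain ⟨a, rfl⟩ := ht
      exact Function.Embedding.nonempty_of_card_le (h a)
    · have : IsEmpty {x // f x = t} := ⟨fun x => ht ⟨x.1, x.2⟩⟩
      exact ⟨Function.Embedding.ofIsEmpty⟩
  let E : ∀ t, {x // f x = t} ↪ {y // g y = t} := fun t => (hE t).some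
  refine ⟨fun a => (E (f a) ⟨a, rfl⟩).1, fun a b hab => ?_, fun a => (E (f a) ⟨a, rfl⟩).2⟩
  have hf : f b = f a := by
    have h1 := (E (f a) ⟨a, rfl⟩).2
    have h2 := (E (f b) ⟨b, rfl⟩).2
    have hab' : (E (f a) ⟨a, rfl⟩).1 = (E (f b) ⟨b, rfl⟩).1 := hab
    rw [← h1, ← h2, hab']
  have key : ∀ t (ht : f b = t), (E (f b) ⟨b, rfl⟩).1 = (E t ⟨b, ht⟩).1 := by
    rintro _ rfl
    rfl
  have := (E (f a)).injective (Subtype.ext (hab.trans (key _ hf)))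
  exact congrArg Subtype.val this

/-- In every block of `2 * M` positions, a pair of cells and the reversed pair alternate; the pairs
`pr 0, …, pr (Q - 1)` take turns in successive blocks. -/
def cellPattern {γ : Type*} (pr : ℕ → γ × γ) (Q M j : ℕ) : γ × γ :=
  if j % 2 = 0 then pr (j / (2 * M) % Q) else (pr (j / (2 * M) % Q)).swap

/-- Positions `j` and `j + 2 * M * Q` carry the same type: they are what the two arms handle
simultaneously. -/
theorem cellPattern_add {γ : Type*} (pr : ℕ → γ × γ) (Q M j : ℕ) :
    cellPattern pr Q M (j + 2 * M * Q) = cellPattern pr Q M j := by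
  rcases Nat.eq_zero_or_pos M with rfl | hM
  · simp
  · have h1 : (j + 2 * M * Q) / (2 * M) % Q = j / (2 * M) % Q := by
      rw [Nat.add_mul_div_left _ _ (by positivity), Nat.add_mod_right]
    have h2 : (j + 2 * M * Q) % 2 = j % 2 := by
      rw [mul_assoc, Nat.add_mul_mod_self_left]
    simp only [cellPattern, h1, h2]

/-- Inside a block a pair is followed by its reversal, so the transit from a goal to the next start
stays in one cell. Only at block ends can it be long. -/
theorem cellPattern_succ {γ : Type*} (pr : ℕ → γ × γ) (Q M j : ℕ) (hj : (j + 1) % (2 * M) ≠ 0) :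
    (cellPattern pr Q M j).2 = (cellPattern pr Q M (j + 1)).1 := by
  have h1 : (j + 1) / (2 * M) = j / (2 * M) := by
    rw [Nat.succ_div, if_neg (fun h => hj (Nat.mod_eq_zero_of_dvd h)), add_zero]
  simp only [cellPattern, h1]
  rcases Nat.mod_two_eq_zero_or_one j with h | h
  · rw [if_pos h, if_neg (by omega), Prod.fst_swap]
  · rw [if_neg (by omega), if_pos (by omega), Prod.snd_swap]

/-- The objects can be listed so that their types follow the pattern. -/
theorem exists_perm_cellPattern {n Q M : ℕ} {γ : Type*} [DecidableEq γ] (typ : Fin n → γ × γ)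
    (pr : ℕ → γ × γ) (hinj : ∀ p < Q, ∀ q < Q, pr p = pr q → p = q)
    (hswap : ∀ p < Q, ∃ q < Q, pr q = (pr p).swap)
    (hcard : ∀ p < Q, 4 * M ≤ Fintype.card {i // typ i = pr p}) :
    4 * M * Q ≤ n ∧ ∃ σ : Equiv.Perm (Fin n), ∀ j : Fin n, (j : ℕ) < 4 * M * Q →
      typ (σ j) = cellPattern pr Q M j := by
  obtain ⟨e, he, het⟩ := exists_injective_comp_eq
    (fun j : Fin (4 * M * Q) => cellPattern pr Q M j) typ (by
    intro j
    have hpos : 0 < 4 * M * Q := j.pos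
    have hM : 0 < M := by
      rcases Nat.eq_zero_or_pos M with rfl | h
      · simp at hpos
      · exact h
    have hQ : 0 < Q := Nat.pos_of_mul_pos_left hpos
    have hlt : ∀ k, k / (2 * M) % Q < Q := fun k => Nat.mod_lt _ hQ
    refine le_trans ?_ (b := 4 * M) ?_
    · have hmaps : ∀ x : {x : Fin (4 * M * Q) // cellPattern pr Q M x = cellPattern pr Q M j},
          (x.1 : ℕ) / (2 * M) / Q < 2 ∧ (x.1 : ℕ) % (2 * M) < 2 * M := by
        rintro ⟨x, -⟩
        refine ⟨?_, Nat.mod_lt _ (by positivity)⟩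
        rw [Nat.div_div_eq_div_mul, Nat.div_lt_iff_lt_mul (by positivity)]
        calc (x : ℕ) < 4 * M * Q := x.2
          _ = 2 * (2 * M * Q) := by ring
      let F : {x : Fin (4 * M * Q) // cellPattern pr Q M x = cellPattern pr Q M j} →
          Fin 2 × Fin (2 * M) := fun x =>
        (⟨(x.1 : ℕ) / (2 * M) / Q, (hmaps x).1⟩, ⟨(x.1 : ℕ) % (2 * M), (hmaps x).2⟩)
      have hF : Function.Injective F := by
        rintro ⟨x, hx⟩ ⟨y, hy⟩ hxy
        simp only [F, Prod.mk.injEq, Fin.mk.injEq] at hxy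
        obtain ⟨h1, h2⟩ := hxy
        have hpar : (x : ℕ) % 2 = (y : ℕ) % 2 := by
          rw [← Nat.mod_mul_right_mod (x : ℕ) 2 M, h2, Nat.mod_mul_right_mod]
        have hxy := hx.trans hy.symm
        have hp : (x : ℕ) / (2 * M) % Q = (y : ℕ) / (2 * M) % Q := by
          refine hinj _ (hlt _) _ (hlt _) ?_
          simp only [cellPattern, hpar] at hxy
          split_ifs at hxy
          · exact hxy
          · exact Prod.swap_injective hxy
        have h3 : (x : ℕ) / (2 * M) = (y : ℕ) / (2 * M) := by
          rw [← Nat.div_add_mod ((x : ℕ) / (2 * M)) Q, h1, hp, Nat.div_add_mod]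
        have h4 : (x : ℕ) = y := by
          rw [← Nat.div_add_mod (x : ℕ) (2 * M), h3, h2, Nat.div_add_mod]
        exact Subtype.ext (Fin.ext h4)
      refine (Fintype.card_le_of_injective F hF).trans ?_
      simp only [Fintype.card_prod, Fintype.card_fin]
      omega
    · obtain ⟨q, hq, hq'⟩ : ∃ q < Q, pr q = cellPattern pr Q M j := by
        simp only [cellPattern]
        split_ifs
        · exact ⟨_, hlt _, rfl⟩
        · exact hswap _ (hlt _)
      have := hcard q hq
      generalize cellPattern pr Q M j = t at hq'
      subst hq'
      exact this)
  have hle : 4 * M * Q ≤ n := by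
    simpa using Fintype.card_le_of_injective e he
  refine ⟨hle, ?_⟩
  obtain ⟨σ, hσ⟩ : ∃ σ : Equiv.Perm (Fin n), ∀ j, σ (Fin.castLE hle j) = e j := by
    let E₁ := Equiv.ofInjective (Fin.castLE hle) (Fin.castLE_injective hle)
    let E₂ := Equiv.ofInjective e he
    refine ⟨(E₁.symm.trans E₂).extendSubtype, fun j => ?_⟩
    rw [Equiv.extendSubtype_apply_of_mem _ _ ⟨j, rfl⟩]
    have : E₁.symm ⟨Fin.castLE hle j, ⟨j, rfl⟩⟩ = j := by
      rw [Equiv.symm_apply_eq]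
      rfl
    simp only [Equiv.trans_apply, this]
    rfl
  refine ⟨σ, fun j hj => ?_⟩
  have := hσ ⟨j, hj⟩
  have h2 : Fin.castLE hle ⟨j, hj⟩ = j := rfl
  rw [h2] at this
  rw [this, het]

/-- Each block has just one end. -/
theorem card_blockEnds_le (N Q M : ℕ) :
    ((Finset.range N).filter fun j => (j + 1) % (2 * M) = 0 ∧ j < 2 * M * Q).card ≤ Q := by
  conv_rhs => rw [← Finset.card_range Q]
  refine Finset.card_le_card_of_injOn (fun j => j / (2 * M)) (fun j hj => ?_) ?_
  · simp only [Finset.coe_filter, Finset.mem_range, Set.mem_ofPred_eq] at hj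
    simp only [Finset.coe_range, Set.mem_Iio]
    exact Nat.div_lt_of_lt_mul hj.2.2
  · intro j hj k hk hjk
    simp only [Finset.coe_filter, Finset.mem_range, Set.mem_ofPred_eq] at hj hk
    simp only at hjk
    have h1 := Nat.div_add_mod (j + 1) (2 * M)
    have h2 := Nat.div_add_mod (k + 1) (2 * M)
    rw [hj.2.1, Nat.succ_div, if_pos (Nat.dvd_of_mod_eq_zero hj.2.1)] at h1
    rw [hk.2.1, Nat.succ_div, if_pos (Nat.dvd_of_mod_eq_zero hk.2.1)] at h2
    rw [hjk] at h1
    omega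

theorem sum_blockEnds_le {S : ℝ} (hS : 0 ≤ S) (N Q M : ℕ) :
    ∑ j ∈ Finset.range N, (if (j + 1) % (2 * M) = 0 ∧ j < 2 * M * Q then S else 0) ≤ Q * S := by
  rw [← Finset.sum_filter, Finset.sum_const, nsmul_eq_mul]
  gcongr
  exact card_blockEnds_le N Q M

theorem sum_range_ite_le (S : ℝ) {N m : ℕ} (h : m ≤ N) :
    ∑ j ∈ Finset.range N, (if m ≤ j then S else 0) = (N - m) * S := by
  rw [← Finset.sum_filter, Finset.sum_const, nsmul_eq_mul]
  have : (Finset.range N).filter (fun j => m ≤ j) = Finset.Ico m N := by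
    ext j
    simp [and_comm]
  rw [this, Nat.card_Ico, Nat.cast_sub h]

/-- Transits inside blocks cost `D`. The `2 * Q` block ends, and the positions beyond the pattern,
cost at most `S` extra each. -/
theorem iInf_transit_le {n Q M : ℕ} {γ : Type*} {ω : Instance n} {κs κg : Fin n → γ} {D S : ℝ}
    {pr : ℕ → γ × γ} (hD : 0 ≤ D) (hS : 0 ≤ S) (hDist : ∀ i j, dist (ω.goal i) (ω.start j) ≤ S)
    (hcell : ∀ i j, κg i = κs j → dist (ω.goal i) (ω.start j) ≤ D)
    (hle : 4 * M * Q ≤ n) {σ : Equiv.Perm (Fin n)}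
    (hσ : ∀ j : Fin n, (j : ℕ) < 4 * M * Q → (κs (σ j), κg (σ j)) = cellPattern pr Q M j) :
    ⨅ σ : Equiv.Perm (Fin n), ∑ j, dist (ω.goal (σ j)) (ω.start (σ (finRotate n j))) ≤
      n * D + (2 * Q + (n - 4 * M * Q)) * S := by
  refine (ciInf_le (Set.finite_range _).bddBelow σ).trans ?_
  let F : ℕ → ℝ := fun j => D +
    (if (j + 1) % (2 * M) = 0 ∧ j < 2 * M * (2 * Q : ℕ) then S else 0) +
    (if 4 * M * Q ≤ j then S else 0)
  have hterm : ∀ j : Fin n, dist (ω.goal (σ j)) (ω.start (σ (finRotate n j))) ≤ F j := by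
    intro j
    simp only [F]
    by_cases h2 : 4 * M * Q ≤ (j : ℕ)
    · rw [if_pos h2]
      have := hDist (σ j) (σ (finRotate n j))
      split_ifs <;> linarith
    · have h2' : (j : ℕ) < 2 * M * (2 * Q : ℕ) := by
        rw [not_le] at h2
        calc (j : ℕ) < 4 * M * Q := h2
          _ = _ := by ring
      rw [if_neg h2, add_zero]
      by_cases h1 : ((j : ℕ) + 1) % (2 * M) = 0
      · rw [if_pos ⟨h1, h2'⟩]
        have := hDist (σ j) (σ (finRotate n j))
        linarith
      · rw [if_neg (fun h => h1 h.1), add_zero]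
        have h3 : (j : ℕ) + 1 < 4 * M * Q := by
          -- The last position of the pattern is itself a block end, so away from block ends the
          -- next position is still in the pattern.
          refine lt_of_le_of_ne (by omega) fun h => h1 ?_
          rw [h, show 4 * M * Q = 2 * M * (2 * Q) by ring, Nat.mul_mod_right]
        have hrot : ((finRotate n j : Fin n) : ℕ) = j + 1 := by
          obtain ⟨N, rfl⟩ : ∃ N, n = N + 1 := ⟨n - 1, by have := j.pos; omega⟩
          rw [coe_finRotate_of_ne_last]
          intro h
          rw [h, Fin.val_last] at h3
          omega
        refine hcell _ _ ?_
        have e1 := congrArg Prod.snd (hσ j (by omega))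
        have e2 := congrArg Prod.fst (hσ (finRotate n j) (by omega))
        simp only at e1 e2
        rw [e1, e2, hrot, cellPattern_succ _ _ _ _ h1]
  calc _ ≤ ∑ j : Fin n, F j := Finset.sum_le_sum fun j _ => hterm j
    _ = ∑ j ∈ Finset.range n, F j := Fin.sum_univ_eq_sum_range F n
    _ ≤ _ := by
      simp only [F, Finset.sum_add_distrib]
      have h1 := sum_blockEnds_le hS n (2 * Q) M
      have h2 := sum_range_ite_le S hle
      rw [h2, Finset.sum_const, Finset.card_range, nsmul_eq_mul]
      push_cast at h1 ⊢
      linarith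

/-! ### The two-arm plan -/

/-- In step `j < W` the arms serve positions `j` and `j + W` of a list of points; afterwards the
first arm serves the remaining points alone and the second one follows it at offset `v`. -/
noncomputable def lockstepPos (x : ℕ → TablePlane) (v : TablePlane) (W j : ℕ) :
    Fin 2 → TablePlane :=
  if j < W then ![x j, x (j + W)] else ![x (j + W), x (j + W) + v]

theorem lockstepPos_of_lt {x : ℕ → TablePlane} {v : TablePlane} {W j : ℕ} (h : j < W) :
    lockstepPos x v W j = ![x j, x (j + W)] := if_pos h

theorem lockstepPos_of_le {x : ℕ → TablePlane} {v : TablePlane} {W j : ℕ} (h : W ≤ j) :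
    lockstepPos x v W j = ![x (j + W), x (j + W) + v] := if_neg (not_lt.2 h)

theorem dist_lockstepPos_le {x y : ℕ → TablePlane} {v : TablePlane} {S : ℝ} (W : ℕ)
    (hxy : ∀ j k, dist (x j) (y k) ≤ S) (j k : ℕ) (a : Fin 2) :
    dist (lockstepPos x v W j a) (lockstepPos y v W k a) ≤ S + ‖v‖ := by
  have h0 : ∀ j k, dist (x j) (y k) ≤ S + ‖v‖ := fun j k =>
    (hxy j k).trans (le_add_of_nonneg_right (norm_nonneg v))
  have h1 : ∀ j k, dist (x j + v) (y k) ≤ S + ‖v‖ := fun j k => by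
    refine (dist_triangle _ (x j) _).trans ?_
    rw [dist_self_add_left, add_comm]
    gcongr
    exact hxy j k
  have h2 : ∀ j k, dist (x j) (y k + v) ≤ S + ‖v‖ := fun j k => by
    refine (dist_triangle _ (y k) _).trans ?_
    rw [dist_self_add_right]
    gcongr
    exact hxy j k
  have h3 : ∀ j k, dist (x j + v) (y k + v) ≤ S + ‖v‖ := fun j k => by
    rw [dist_add_right]
    exact h0 j k
  rcases lt_or_ge j W with hj | hj <;> rcases lt_or_ge k W with hk | hk <;>
    [rw [lockstepPos_of_lt hj, lockstepPos_of_lt hk]; rw [lockstepPos_of_lt hj, lockstepPos_of_le hk];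
    rw [lockstepPos_of_le hj, lockstepPos_of_lt hk];
    rw [lockstepPos_of_le hj, lockstepPos_of_le hk]] <;> revert a <;> rw [Fin.forall_fin_two]
  · exact ⟨h0 _ _, h0 _ _⟩
  · exact ⟨h0 _ _, h2 _ _⟩
  · exact ⟨h0 _ _, h1 _ _⟩
  · exact ⟨h0 _ _, h3 _ _⟩

/-- The averages over `j < W` add up to half of the first `2 * W` terms; the other terms on the
right are nonnegative. -/
theorem sum_range_lockstep_le {D S : ℝ} {n W : ℕ} (hle : 2 * W ≤ n) (d : ℕ → ℝ)
    (hd : ∀ j, 0 ≤ d j) :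
    ∑ j ∈ Finset.range (n - W), (if j < W then (d j + d (j + W)) / 2 + D else S) ≤
      (∑ j ∈ Finset.range n, d j) / 2 + W * D + (n - 2 * W) * S := by
  obtain ⟨R, rfl⟩ := Nat.exists_eq_add_of_le hle
  have h1 : 2 * W + R - W = W + R := by omega
  have h2 : 2 * W + R = W + (W + R) := by omega
  rw [h1]
  conv_rhs => rw [h2]
  rw [Finset.sum_range_add, Finset.sum_range_add, Finset.sum_range_add]
  have h4 : ∑ j ∈ Finset.range W, (if j < W then (d j + d (j + W)) / 2 + D else S) =
      (∑ j ∈ Finset.range W, d j + ∑ j ∈ Finset.range W, d (W + j)) / 2 + W * D := by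
    have h5 : (W : ℝ) * D = ∑ j ∈ Finset.range W, D := by simp
    rw [h5, ← Finset.sum_add_distrib, Finset.sum_div, ← Finset.sum_add_distrib]
    refine Finset.sum_congr rfl fun j hj => ?_
    rw [if_pos (Finset.mem_range.1 hj), add_comm W j]
  have h5 : ∑ j ∈ Finset.range R, (if W + j < W then (d (W + j) + d (W + j + W)) / 2 + D else S) =
      R * S := by
    rw [Finset.sum_congr rfl fun j _ => if_neg (by omega)]
    simp
  have h6 : 0 ≤ ∑ j ∈ Finset.range R, d (W + (W + j)) := Finset.sum_nonneg fun _ _ => hd _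
  rw [h4, h5]
  push_cast
  linarith

/-- Lockstep costs the maximum of two transfer lengths rather than their mean. Objects of equal type
differ in length by at most `2 * D`, so the maximum exceeds the mean by at most `D`. The few objects
outside the pattern go to one arm. -/
theorem exists_plan_le {n Q M : ℕ} {γ : Type*} {ω : Instance n} {κs κg : Fin n → γ} {D S : ℝ}
    {cp cd ct r : ℝ} (hcp : 0 ≤ cp) (hcd : 0 ≤ cd) (hct : 0 < ct) (hr : 0 ≤ r) (hn : 0 < n)
    {pr : ℕ → γ × γ} (hD : 0 ≤ D) (hS : 0 ≤ S) (hDist : ∀ i j, dist (ω.goal i) (ω.start j) ≤ S)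
    (hcell : ∀ i j, κg i = κs j → dist (ω.goal i) (ω.start j) ≤ D)
    (htype : ∀ i j, κs i = κs j → κg i = κg j →
      dist (ω.start i) (ω.goal i) ≤ dist (ω.start j) (ω.goal j) + 2 * D)
    (hle : 4 * M * Q ≤ n) {σ : Equiv.Perm (Fin n)}
    (hσ : ∀ j : Fin n, (j : ℕ) < 4 * M * Q → (κs (σ j), κg (σ j)) = cellPattern pr Q M j) :
    ∃ P : TwoArmPlan ω cp cd ct r,
      P.makespan ≤ (n - 2 * M * Q) * (cp + cd + 16 * r * ct) +
        ct * ((∑ i, dist (ω.start i) (ω.goal i)) / 2 + n * D +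
          (Q + 2 * (n - 4 * M * Q)) * (S + 2 * r)) := by
  -- `W` is one period of the pattern, so the first `2 * W` positions split into two lists of
  -- identical types.
  set W := 2 * M * Q with hW
  have hW2 : 4 * M * Q = 2 * W := by rw [hW]; ring
  rw [hW2] at hle
  simp only [hW2] at hσ
  have hWn : W < n ∨ n = 0 := by omega
  set h := n - W with hh
  have hh0 : 0 < h := by omega
  let o : ℕ → Fin n := fun j => σ ⟨j % n, Nat.mod_lt _ hn⟩
  have ho : ∀ q (hq : q < n), o q = σ ⟨q, hq⟩ := fun q hq => by
    simp only [o, Nat.mod_eq_of_lt hq]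
  have hoσ : ∀ i, o (σ.symm i : ℕ) = i := fun i => by
    rw [ho _ (σ.symm i).2, Fin.eta, Equiv.apply_symm_apply]
  have hpat : ∀ q, q < 2 * W → (κs (o q), κg (o q)) = cellPattern pr Q M q := fun q hq => by
    rw [ho q (by omega)]
    exact hσ _ hq
  have hpatW : ∀ q, q < W → (κs (o (q + W)), κg (o (q + W))) = cellPattern pr Q M q := fun q hq => by
    rw [hpat _ (by omega), hW, cellPattern_add]
  set v : TablePlane := EuclideanSpace.single 0 (2 * r) with hv
  have hv1 : ‖v‖ = 2 * r := by
    rw [hv, PiLp.norm_single, Real.norm_of_nonneg (by positivity)]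
  let pos : (Fin n → TablePlane) → ℕ → Fin 2 → TablePlane := fun x j =>
    lockstepPos (fun q => x (o q)) v W j
  have pos_lt : ∀ x j, j < W → pos x j = ![x (o j), x (o (j + W))] := fun x j hj =>
    lockstepPos_of_lt hj
  have pos_ge : ∀ x j, W ≤ j → pos x j = ![x (o (j + W)), x (o (j + W)) + v] := fun x j hj =>
    lockstepPos_of_le hj
  let step : Fin n → ℕ := fun i => if (σ.symm i : ℕ) < W then σ.symm i else σ.symm i - W
  let arm : Fin n → Fin 2 := fun i =>
    if W ≤ (σ.symm i : ℕ) ∧ (σ.symm i : ℕ) < 2 * W then 1 else 0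
  have hstep : ∀ i, step i < h := by
    intro i
    have := (σ.symm i).2
    simp only [step]
    split_ifs <;> omega
  have hpos : ∀ x i, pos x (step i) (arm i) = x i := by
    intro x i
    have hi := hoσ i
    simp only [step, arm]
    by_cases h1 : (σ.symm i : ℕ) < W
    · rw [if_pos h1, if_neg (by omega), pos_lt _ _ h1, Matrix.cons_val_zero, hi]
    · by_cases h2 : (σ.symm i : ℕ) < 2 * W
      · rw [if_neg h1, if_pos ⟨by omega, h2⟩, pos_lt _ _ (by omega), Matrix.cons_val_one,
          Matrix.cons_val_fin_one, Nat.sub_add_cancel (by omega), hi]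
      · rw [if_neg h1, if_neg (by omega), pos_ge _ _ (by omega), Matrix.cons_val_zero,
          Nat.sub_add_cancel (by omega), hi]
  have hinj : ∀ i j, step i = step j → arm i = arm j → i = j := by
    intro i j h1 h2
    have : (σ.symm i : ℕ) = σ.symm j := by
      simp only [step, arm] at h1 h2
      split_ifs at h1 h2 <;> omega
    exact σ.symm.injective (Fin.ext this)
  -- Reduction modulo `h` makes the step after the last one the first, which closes the loop.
  let A : ℕ → Fin 2 → TablePlane := fun j => pos ω.start (j % h)
  let B : ℕ → Fin 2 → TablePlane := fun j => pos ω.goal (j % h)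
  have hA : ∀ j, j < h → A j = pos ω.start j := fun j hj => by
    simp only [A, Nat.mod_eq_of_lt hj]
  have hB : ∀ j, j < h → B j = pos ω.goal j := fun j hj => by
    simp only [B, Nat.mod_eq_of_lt hj]
  let d : Fin n → ℝ := fun i => dist (ω.start i) (ω.goal i)
  let l : ℕ → ℝ := fun j => if j < W then (d (o j) + d (o (j + W))) / 2 + D else S
  let l' : ℕ → ℝ := fun j => D +
    (if (j + 1) % (2 * M) = 0 ∧ j < 2 * M * Q then S + 2 * r else 0) +
    (if W ≤ j then S + 2 * r else 0)
  have hpp : ∀ j k a, dist (pos ω.goal j a) (pos ω.start k a) ≤ S + 2 * r := by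
    intro j k a
    have := dist_lockstepPos_le (v := v) W (fun j k => hDist (o j) (o k)) j k a
    rwa [hv1] at this
  obtain ⟨P, hP⟩ := exists_lockstep_plan (ω := ω) hcp hcd hct hr h step arm hinj hstep A B
    (fun i => by rw [hA _ (hstep i), hpos]) (fun i => by rw [hB _ (hstep i), hpos])
    (by simp [A]) (by
      intro j hj
      rcases lt_or_ge j W with hjW | hjW
      · left
        intro a
        fin_cases a
        · refine ⟨o j, ?_⟩
          have : (σ.symm (o j) : ℕ) = j := by
            rw [ho _ (by omega), Equiv.symm_apply_apply]
          simp only [step, arm, this, if_pos hjW]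
          exact ⟨trivial, if_neg (by omega)⟩
        · refine ⟨o (j + W), ?_⟩
          have : (σ.symm (o (j + W)) : ℕ) = j + W := by
            rw [ho _ (by omega), Equiv.symm_apply_apply]
          simp only [step, arm, this]
          exact ⟨by rw [if_neg (by omega)]; omega, if_pos (by omega)⟩
      · right
        rw [hA j hj, hB j hj, pos_ge _ _ hjW, pos_ge _ _ hjW]
        simp [hv1]) l l' (by
      intro j hj a
      rw [hA j hj, hB j hj]
      simp only [l]
      split_ifs with hjW
      · rw [pos_lt _ _ hjW, pos_lt _ _ hjW]
        have e := (hpat j (by omega)).trans (hpatW j hjW).symm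
        simp only [Prod.mk.injEq] at e
        have h1 := htype _ _ e.1 e.2
        have h2 := htype _ _ e.1.symm e.2.symm
        fin_cases a <;> simp [d] <;> linarith
      · rw [pos_ge _ _ (not_lt.1 hjW), pos_ge _ _ (not_lt.1 hjW)]
        have := hDist (o (j + W)) (o (j + W))
        rw [dist_comm] at this
        fin_cases a <;> simpa using this) (by
      intro j hj a
      rw [hB j hj]
      have hbig := hpp j ((j + 1) % h) a
      have hS2 : 0 ≤ S + 2 * r := by positivity
      change dist (pos ω.goal j a) (pos ω.start ((j + 1) % h) a) ≤ l' j
      simp only [l']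
      by_cases h1 : W ≤ j
      · rw [if_pos h1]
        split_ifs <;> linarith
      · rw [if_neg h1]
        by_cases h2 : (j + 1) % (2 * M) = 0
        · rw [if_pos ⟨h2, by omega⟩]
          linarith
        · have h3 : j + 1 < W := by
            refine lt_of_le_of_ne (by omega) fun h => h2 ?_
            rw [h, hW, Nat.mul_mod_right]
          rw [if_neg (fun h => h2 h.1), Nat.mod_eq_of_lt (by omega), pos_lt _ _ (by omega),
            pos_lt _ _ h3, add_zero, add_zero]
          have e := cellPattern_succ pr Q M j h2
          fin_cases a
          · rw [← hpat _ (by omega), ← hpat _ (by omega)] at e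
            exact hcell _ _ e
          · rw [← hpatW _ (by omega), ← hpatW _ (by omega)] at e
            exact hcell _ _ e)
  refine ⟨P, hP.trans ?_⟩
  have hcast : (h : ℝ) = n - W := by rw [hh, Nat.cast_sub (by omega)]
  have hsplit : ∑ j ∈ Finset.range h, l j ≤ (∑ i, d i) / 2 + W * D + (h - W) * S := by
    have h2 : ∑ i, d i = ∑ j ∈ Finset.range n, d (o j) := by
      rw [← Fin.sum_univ_eq_sum_range (fun j => d (o j)) n, ← Equiv.sum_comp σ]
      exact Finset.sum_congr rfl fun j _ => by rw [ho _ j.2]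
    have h3 := sum_range_lockstep_le (D := D) (S := S) hle (fun j => d (o j))
      (fun _ => dist_nonneg)
    rw [h2, hcast]
    linarith
  have hsplit' : ∑ j ∈ Finset.range h, l' j ≤
      h * D + Q * (S + 2 * r) + (h - W) * (S + 2 * r) := by
    simp only [l', Finset.sum_add_distrib]
    have h1 := sum_blockEnds_le (S := S + 2 * r) (by positivity) h Q M
    have h2 := sum_range_ite_le (S + 2 * r) (m := W) (N := h) (by omega)
    rw [h2, Finset.sum_const, Finset.card_range, nsmul_eq_mul]
    linarith
  have hsum : ∑ j ∈ Finset.range h, (cp + cd + ct * (l j + l' j + 16 * r)) =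
      h * (cp + cd + 16 * r * ct) +
        ct * (∑ j ∈ Finset.range h, l j + ∑ j ∈ Finset.range h, l' j) := by
    rw [← Finset.sum_add_distrib, Finset.mul_sum, ← nsmul_eq_mul, ← Finset.card_range h,
      ← Finset.sum_const, Finset.card_range, ← Finset.sum_add_distrib]
    exact Finset.sum_congr rfl fun j _ => by ring
  have hWc : (W : ℝ) = 2 * M * Q := by rw [hW]; push_cast; ring
  have hRn : (0 : ℝ) ≤ n - 2 * W := by
    have : ((2 * W : ℕ) : ℝ) ≤ n := by exact_mod_cast hle
    push_cast at this
    linarith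
  have hRr : 0 ≤ (n - 2 * W : ℝ) * r := mul_nonneg hRn hr
  rw [hsum, hcast, ← hWc, show (4 * M * Q : ℝ) = 2 * W by rw [hWc]; ring]
  rw [hcast] at hsplit hsplit'
  have hd : ∑ i, d i = ∑ i, dist (ω.start i) (ω.goal i) := rfl
  rw [hd] at hsplit
  have key : ∑ j ∈ Finset.range h, l j + ∑ j ∈ Finset.range h, l' j ≤
      (∑ i, dist (ω.start i) (ω.goal i)) / 2 + n * D + (Q + 2 * (n - 2 * W)) * (S + 2 * r) := by
    linarith
  have := mul_le_mul_of_nonneg_left key hct.le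
  linarith

/-! ### The mean distance of two points of the square -/

theorem continuous_unitInterval_parametric {F : ℝ → ℝ → ℝ} (hF : Continuous (Function.uncurry F)) :
    Continuous fun x => ∫ y in (0 : ℝ)..1, F x y :=
  intervalIntegral.continuous_parametric_intervalIntegral_of_continuous' hF 0 1

/-- The distance of two uniform points of the unit interval has density `2 * (1 - z)`. -/
theorem integral_integral_abs_sub {φ : ℝ → ℝ} (hφ : Continuous φ) :
    ∫ x in (0 : ℝ)..1, ∫ u in (0 : ℝ)..1, φ |x - u| = ∫ z in (0 : ℝ)..1, 2 * (1 - z) * φ z := by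
  set Φ : ℝ → ℝ := fun x => ∫ z in (0 : ℝ)..x, φ z with hΦ
  have hΦd : ∀ x, HasDerivAt Φ (φ x) x := fun x =>
    intervalIntegral.integral_hasDerivAt_right (hφ.intervalIntegrable _ _)
      (hφ.stronglyMeasurableAtFilter _ _) hφ.continuousAt
  have hΦc : Continuous Φ := continuous_iff_continuousAt.2 fun x => (hΦd x).continuousAt
  have hinner : ∀ x ∈ Icc (0 : ℝ) 1, ∫ u in (0 : ℝ)..1, φ |x - u| = Φ x + Φ (1 - x) := by
    intro x hx
    have hc : Continuous fun u => φ |x - u| := by fun_prop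
    rw [← intervalIntegral.integral_add_adjacent_intervals (hc.intervalIntegrable 0 x)
      (hc.intervalIntegrable x 1)]
    congr 1
    · rw [intervalIntegral.integral_congr (g := fun u => φ (x - u)) fun u hu => ?_,
        intervalIntegral.integral_comp_sub_left]
      · simp [hΦ]
      · rw [uIcc_of_le hx.1] at hu
        simp only [abs_of_nonneg (sub_nonneg.2 hu.2)]
    · rw [intervalIntegral.integral_congr (g := fun u => φ (u - x)) fun u hu => ?_,
        intervalIntegral.integral_comp_sub_right]
      · simp [hΦ]
      · rw [uIcc_of_le hx.2] at hu
        simp only [abs_sub_comm x u, abs_of_nonneg (sub_nonneg.2 hu.1)]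
  rw [intervalIntegral.integral_congr (g := fun x => Φ x + Φ (1 - x)) fun x hx => hinner x (by
    rwa [uIcc_of_le zero_le_one] at hx), intervalIntegral.integral_add (hΦc.intervalIntegrable _ _)
    ((by fun_prop : Continuous fun x => Φ (1 - x)).intervalIntegrable _ _),
    intervalIntegral.integral_comp_sub_left]
  -- The double integral has become `2 * ∫ Φ`; parts against `2 * (1 - z)` leave no boundary term,
  -- as `Φ 0 = 0`.
  have hparts := intervalIntegral.integral_mul_deriv_eq_deriv_mul (a := 0) (b := 1)
    (u := fun z : ℝ => 2 * (1 - z)) (u' := fun _ => -2) (v := Φ) (v' := φ)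
    (fun x _ => by simpa using ((hasDerivAt_id x).const_sub 1).const_mul 2)
    (fun x _ => hΦd x) (by simp) (hφ.intervalIntegrable _ _)
  rw [hparts, intervalIntegral.integral_const_mul]
  simp [hΦ]
  ring

theorem integrable_triangle {h : ℝ → ℝ → ℝ} (hh : Continuous (Function.uncurry h)) :
    Integrable (Function.uncurry fun z w => if z ≤ w then h z w else 0)
      ((volume.restrict (uIoc (0 : ℝ) 1)).prod (volume.restrict (uIoc (0 : ℝ) 1))) := by
  rw [Measure.prod_restrict]
  have h1 : IntegrableOn (Function.uncurry h) (uIoc (0 : ℝ) 1 ×ˢ uIoc (0 : ℝ) 1)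
      ((volume : Measure ℝ).prod volume) := by
    refine (hh.continuousOn.integrableOn_compact
      (isCompact_Icc.prod isCompact_Icc : IsCompact (Icc (0 : ℝ) 1 ×ˢ Icc (0 : ℝ) 1))).mono_set ?_
    rw [uIoc_of_le zero_le_one]
    exact prod_mono Ioc_subset_Icc_self Ioc_subset_Icc_self
  have h2 : MeasurableSet {p : ℝ × ℝ | p.1 ≤ p.2} :=
    measurableSet_le measurable_fst measurable_snd
  refine (h1.indicator h2).congr (Eventually.of_forall fun p => ?_)
  simp [Set.indicator, Function.uncurry]

/-- The integral of a symmetric function over the unit square is twice that over a triangle. -/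
theorem integral_integral_symm {h : ℝ → ℝ → ℝ} (hh : Continuous (Function.uncurry h))
    (hsymm : ∀ z w, h z w = h w z) :
    ∫ z in (0 : ℝ)..1, ∫ w in (0 : ℝ)..1, h z w = 2 * ∫ z in (0 : ℝ)..1, ∫ w in (0 : ℝ)..z, h z w := by
  have hz : ∀ z, Continuous fun w => h z w := fun z => 
    hh.comp (by fun_prop : Continuous fun w : ℝ => (z, w))
  have hJc : Continuous fun z => ∫ w in (0 : ℝ)..z, h z w :=
    intervalIntegral.continuous_parametric_intervalIntegral_of_continuous hh continuous_id
  have hIc := continuous_unitInterval_parametric hh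
  have hsplit : ∀ z, ∫ w in z..(1 : ℝ), h z w =
      (∫ w in (0 : ℝ)..1, h z w) - ∫ w in (0 : ℝ)..z, h z w := fun z => by
    rw [eq_sub_iff_add_eq, add_comm]
    exact intervalIntegral.integral_add_adjacent_intervals ((hz z).intervalIntegrable _ _)
      ((hz z).intervalIntegrable _ _)
  -- Fubini over the triangle `z ≤ w`; symmetry then turns it into the other triangle.
  have key : ∫ z in (0 : ℝ)..1, ∫ w in z..(1 : ℝ), h z w =
      ∫ z in (0 : ℝ)..1, ∫ w in (0 : ℝ)..z, h z w := by
    have e1 : ∀ z ∈ uIcc (0 : ℝ) 1, ∫ w in z..(1 : ℝ), h z w =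
        ∫ w in (0 : ℝ)..1, if z ≤ w then h z w else 0 := by
      intro z hz'
      rw [uIcc_of_le zero_le_one] at hz'
      rw [intervalIntegral.integral_of_le hz'.2, intervalIntegral.integral_of_le zero_le_one]
      have : (fun w => if z ≤ w then h z w else 0) = (Ici z).indicator fun w => h z w := by
        ext w
        simp [Set.indicator]
      rw [this, setIntegral_indicator measurableSet_Ici]
      refine setIntegral_congr_set ?_
      have : (Ioc (0 : ℝ) 1 ∩ Ici z : Set ℝ) =ᵐ[volume] (Ioc (0 : ℝ) 1 ∩ Ioi z : Set ℝ) :=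
        (ae_eq_refl _).inter Ioi_ae_eq_Ici.symm
      have h2 : Ioc (0 : ℝ) 1 ∩ Ioi z = Ioc z 1 := by
        ext w
        exact ⟨fun hw => ⟨hw.2, hw.1.2⟩, fun hw => ⟨⟨hz'.1.trans_lt hw.1, hw.2⟩, hw.1⟩⟩
      rw [h2] at this
      exact this.symm
    have e2 : ∀ w ∈ uIcc (0 : ℝ) 1, (∫ z in (0 : ℝ)..1, if z ≤ w then h z w else 0) =
        ∫ z in (0 : ℝ)..w, h w z := by
      intro w hw
      rw [uIcc_of_le zero_le_one] at hw
      rw [← intervalIntegral.integral_indicator hw]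
      congr 1
      ext z
      simp [Set.indicator, hsymm z w]
    rw [intervalIntegral.integral_congr e1,
      intervalIntegral_intervalIntegral_swap (by
        have := integrable_triangle hh
        rwa [Measure.prod_restrict] at this),
      intervalIntegral.integral_congr e2]
  simp only [hsplit] at key
  rw [intervalIntegral.integral_sub (hIc.intervalIntegrable _ _) (hJc.intervalIntegrable _ _)]
    at key
  linarith

theorem integral_sqrt_one_add_sq :
    ∫ t in (0 : ℝ)..1, √(1 + t ^ 2) = (√2 + Real.log (1 + √2)) / 2 := by
  have hd : ∀ t : ℝ, HasDerivAt (fun t => (t * √(1 + t ^ 2) + Real.arsinh t) / 2)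
      (√(1 + t ^ 2)) t := by
    intro t
    have hpos : (0 : ℝ) < 1 + t ^ 2 := by positivity
    have h1 : HasDerivAt (fun t : ℝ => √(1 + t ^ 2)) (2 * t / (2 * √(1 + t ^ 2))) t := by
      refine HasDerivAt.sqrt ?_ hpos.ne'
      simpa using (hasDerivAt_pow 2 t).const_add 1
    refine ((((hasDerivAt_id t).mul h1).add (Real.hasDerivAt_arsinh t)).div_const 2).congr_deriv ?_
    have hs : √(1 + t ^ 2) ≠ 0 := (Real.sqrt_pos.2 hpos).ne'
    have hs2 : √(1 + t ^ 2) ^ 2 = 1 + t ^ 2 := Real.sq_sqrt hpos.le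
    simp only [id_eq]
    field_simp
    linarith
  rw [intervalIntegral.integral_eq_sub_of_hasDerivAt (fun t _ => hd t)
    ((by fun_prop : Continuous fun t : ℝ => √(1 + t ^ 2)).intervalIntegrable _ _)]
  have h2 : (1 : ℝ) + 1 = 2 := by norm_num
  simp [Real.arsinh, h2]

theorem integral_mul_sqrt_one_add_sq :
    ∫ t in (0 : ℝ)..1, t * √(1 + t ^ 2) = (2 * √2 - 1) / 3 := by
  have hd : ∀ t : ℝ, HasDerivAt (fun t => (1 + t ^ 2) * √(1 + t ^ 2) / 3)
      (t * √(1 + t ^ 2)) t := by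
    intro t
    have hpos : (0 : ℝ) < 1 + t ^ 2 := by positivity
    have h0 : HasDerivAt (fun t : ℝ => 1 + t ^ 2) (2 * t) t := by
      simpa using (hasDerivAt_pow 2 t).const_add 1
    refine ((h0.mul (h0.sqrt hpos.ne')).div_const 3).congr_deriv ?_
    have hs : √(1 + t ^ 2) ≠ 0 := (Real.sqrt_pos.2 hpos).ne'
    have hs2 : √(1 + t ^ 2) ^ 2 = 1 + t ^ 2 := Real.sq_sqrt hpos.le
    field_simp
    rw [hs2]
    ring
  rw [intervalIntegral.integral_eq_sub_of_hasDerivAt (fun t _ => hd t)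
    ((by fun_prop : Continuous fun t : ℝ => t * √(1 + t ^ 2)).intervalIntegrable _ _)]
  have h2 : (1 : ℝ) + 1 = 2 := by norm_num
  simp [h2]
  ring

theorem integral_integral_sqrt_eq_meanSegmentLength :
    ∫ z in (0 : ℝ)..1, 2 * (1 - z) * ∫ w in (0 : ℝ)..1, 2 * (1 - w) * √(z ^ 2 + w ^ 2) =
      meanSegmentLength := by
  let h : ℝ → ℝ → ℝ := fun z w => 2 * (1 - z) * (2 * (1 - w) * √(z ^ 2 + w ^ 2))
  have hh : Continuous (Function.uncurry h) := by
    simp only [h, Function.uncurry_def]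
    fun_prop
  have hJ : ∀ z ∈ uIcc (0 : ℝ) 1, ∫ w in (0 : ℝ)..z, h z w =
      4 * (∫ t in (0 : ℝ)..1, √(1 + t ^ 2)) * (z ^ 2 - z ^ 3) -
      4 * (∫ t in (0 : ℝ)..1, t * √(1 + t ^ 2)) * (z ^ 3 - z ^ 4) := by
    intro z hz
    rw [uIcc_of_le zero_le_one] at hz
    -- The substitution w = zt pulls `z` out of the root by homogeneity, which separates the
    -- variables.
    have e := intervalIntegral.mul_integral_comp_mul_left (a := 0) (b := 1) (f := h z) z
    rw [mul_zero, mul_one] at e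
    rw [← e]
    have e2 : ∀ t : ℝ, h z (z * t) =
        4 * (z - z ^ 2) * √(1 + t ^ 2) - 4 * (z ^ 2 - z ^ 3) * (t * √(1 + t ^ 2)) := by
      intro t
      have : √(z ^ 2 + (z * t) ^ 2) = z * √(1 + t ^ 2) := by
        rw [show z ^ 2 + (z * t) ^ 2 = z ^ 2 * (1 + t ^ 2) by ring, Real.sqrt_mul (sq_nonneg z),
          Real.sqrt_sq hz.1]
      simp only [h, this]
      ring
    simp only [e2]
    rw [intervalIntegral.integral_sub, intervalIntegral.integral_const_mul,
      intervalIntegral.integral_const_mul]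
    · ring
    · exact Continuous.intervalIntegrable (by fun_prop) _ _
    · exact Continuous.intervalIntegrable (by fun_prop) _ _
  have hsym := integral_integral_symm hh (fun z w => by
    simp only [h, add_comm (z ^ 2)]
    ring)
  have hl : ∀ z : ℝ, 2 * (1 - z) * ∫ w in (0 : ℝ)..1, 2 * (1 - w) * √(z ^ 2 + w ^ 2) =
      ∫ w in (0 : ℝ)..1, h z w := fun z => (intervalIntegral.integral_const_mul _ _).symm
  simp only [hl]
  rw [hsym, intervalIntegral.integral_congr hJ, intervalIntegral.integral_sub
    (Continuous.intervalIntegrable (by fun_prop) _ _)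
    (Continuous.intervalIntegrable (by fun_prop) _ _),
    intervalIntegral.integral_const_mul, intervalIntegral.integral_const_mul,
    intervalIntegral.integral_sub (by simp) (by simp),
    intervalIntegral.integral_sub (by simp) (by simp), integral_sqrt_one_add_sq,
    integral_mul_sqrt_one_add_sq]
  simp only [integral_pow, meanSegmentLength]
  norm_num
  ring

/-! ### Uniform points in the square -/

/-- The uniform distribution on the unit interval. -/
noncomputable def uniformInterval : Measure ℝ := volume.restrict (Icc 0 1)

instance : IsProbabilityMeasure uniformInterval := ⟨by simp [uniformInterval]⟩

theorem integral_uniformInterval (f : ℝ → ℝ) :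
    ∫ x, f x ∂uniformInterval = ∫ x in (0 : ℝ)..1, f x := by
  rw [intervalIntegral.integral_of_le zero_le_one, uniformInterval, integral_Icc_eq_integral_Ioc]

theorem measurableSet_unitSquare : MeasurableSet unitSquare := by
  have : unitSquare = ⋂ i, (fun x : TablePlane => x i) ⁻¹' Icc 0 1 := by
    ext x
    simp [unitSquare]
  rw [this]
  exact MeasurableSet.iInter fun i => measurableSet_Icc.preimage (by fun_prop)

theorem measurePreserving_uniformSquare :
    MeasurePreserving (fun x : TablePlane => (x 0, x 1)) uniformSquare
      (uniformInterval.prod uniformInterval) := by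
  have h := (volume_preserving_finTwoArrow ℝ).comp (PiLp.volume_preserving_ofLp (Fin 2))
  have h2 := h.restrict_preimage (s := Icc (0 : ℝ) 1 ×ˢ Icc (0 : ℝ) 1)
    (measurableSet_Icc.prod measurableSet_Icc)
  have h3 : (MeasurableEquiv.finTwoArrow ∘ WithLp.ofLp) ⁻¹' (Icc (0 : ℝ) 1 ×ˢ Icc (0 : ℝ) 1) =
      unitSquare := by
    ext x
    change (x 0, x 1) ∈ Icc (0 : ℝ) 1 ×ˢ Icc (0 : ℝ) 1 ↔ ∀ i, x i ∈ Icc (0 : ℝ) 1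
    rw [Fin.forall_fin_two, mem_prod]
  rw [h3, Measure.volume_eq_prod, ← Measure.prod_restrict] at h2
  exact h2

instance : IsProbabilityMeasure uniformSquare :=
  ⟨by simpa using measurePreserving_uniformSquare.measure_preimage nullMeasurableSet_univ⟩

/-- Used to regroup two points of the square into the two pairs of like coordinates, whose
differences alone determine the distance. -/
theorem measurePreserving_prodProdProdComm {α β γ δ : Type*} [MeasurableSpace α]
    [MeasurableSpace β] [MeasurableSpace γ] [MeasurableSpace δ] (a : Measure α) (b : Measure β)
    (c : Measure γ) (d : Measure δ) [SFinite a] [SFinite b] [SFinite c] [SFinite d] :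
    MeasurePreserving (fun p : (α × β) × γ × δ => ((p.1.1, p.2.1), (p.1.2, p.2.2)))
      ((a.prod b).prod (c.prod d)) ((a.prod c).prod (b.prod d)) := by
  have h1 : MeasurePreserving (fun p : β × γ × δ => (p.2.1, p.1, p.2.2)) (b.prod (c.prod d))
      (c.prod (b.prod d)) :=
    (measurePreserving_prodAssoc c b d).comp
      (((Measure.measurePreserving_swap (μ := b) (ν := c)).prod (MeasurePreserving.id d)).comp
        (measurePreserving_prodAssoc b c d).symm)
  exact (measurePreserving_prodAssoc a c (b.prod d)).symm.comp
    (((MeasurePreserving.id a).prod h1).comp (measurePreserving_prodAssoc a b (c.prod d)))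

theorem integral_dist_uniformSquare :
    ∫ p, dist p.1 p.2 ∂(uniformSquare.prod uniformSquare) = meanSegmentLength := by
  have hmp := (measurePreserving_prodProdProdComm uniformInterval uniformInterval uniformInterval
    uniformInterval).comp (measurePreserving_uniformSquare.prod measurePreserving_uniformSquare)
  let G : (ℝ × ℝ) × ℝ × ℝ → ℝ := fun q => √(|q.1.1 - q.1.2| ^ 2 + |q.2.1 - q.2.2| ^ 2)
  have hG : Continuous G := by fun_prop
  have h1 : ∫ p, dist p.1 p.2 ∂(uniformSquare.prod uniformSquare) =
      ∫ q, G q ∂((uniformInterval.prod uniformInterval).prod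
        (uniformInterval.prod uniformInterval)) := by
    rw [← hmp.map_eq, integral_map hmp.measurable.aemeasurable hG.aestronglyMeasurable]
    refine integral_congr_ae (Eventually.of_forall fun p => ?_)
    simp [G, EuclideanSpace.dist_eq, Fin.sum_univ_two, Real.dist_eq]
  have hU : ∀ᵐ x ∂uniformInterval, x ∈ Icc (0 : ℝ) 1 := ae_restrict_mem measurableSet_Icc
  have hint : Integrable G ((uniformInterval.prod uniformInterval).prod
        (uniformInterval.prod uniformInterval)) := by
    simp only [uniformInterval, Measure.prod_restrict]
    exact hG.continuousOn.integrableOn_compact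
      ((isCompact_Icc.prod isCompact_Icc).prod (isCompact_Icc.prod isCompact_Icc))
  have h2 : ∀ φ : ℝ → ℝ, Continuous φ →
      ∫ q, φ |q.1 - q.2| ∂(uniformInterval.prod uniformInterval) =
        ∫ z in (0 : ℝ)..1, 2 * (1 - z) * φ z := by
    intro φ hφ
    have hint : Integrable (fun q : ℝ × ℝ => φ |q.1 - q.2|)
        (uniformInterval.prod uniformInterval) := by
      simp only [uniformInterval, Measure.prod_restrict]
      exact (by fun_prop : Continuous fun q : ℝ × ℝ => φ |q.1 - q.2|).continuousOn.integrableOn_compact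
        (isCompact_Icc.prod isCompact_Icc)
    rw [integral_prod _ hint]
    simp only [integral_uniformInterval]
    exact integral_integral_abs_sub hφ
  rw [h1, integral_prod _ hint]
  have h3 : ∀ q : ℝ × ℝ, ∫ q', G (q, q') ∂(uniformInterval.prod uniformInterval) =
      ∫ w in (0 : ℝ)..1, 2 * (1 - w) * √(|q.1 - q.2| ^ 2 + w ^ 2) := fun q =>
    h2 (fun w => √(|q.1 - q.2| ^ 2 + w ^ 2)) (by fun_prop)
  simp only [h3]
  have h4 : Continuous fun z : ℝ => ∫ w in (0 : ℝ)..1, 2 * (1 - w) * √(z ^ 2 + w ^ 2) :=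
    continuous_unitInterval_parametric (F := fun z w => 2 * (1 - w) * √(z ^ 2 + w ^ 2)) (by
      simp only [Function.uncurry_def]
      fun_prop)
  rw [h2 _ h4, integral_integral_sqrt_eq_meanSegmentLength]

/-! ### Grid cells -/

/-- The index of the grid cell of side length `1 / m` that contains a point. -/
noncomputable def gridCell (m : ℕ) (x : TablePlane) : ℤ × ℤ := (⌊m * x 0⌋, ⌊m * x 1⌋)

theorem uniformInterval_floor {m : ℕ} {a : ℤ} (ha : 0 ≤ a) (ham : a < m) :
    uniformInterval {x | ⌊m * x⌋ = a} = ENNReal.ofReal (1 / m) := by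
  have hm : (0 : ℝ) < m := by
    have : (0 : ℤ) < m := ha.trans_lt ham
    exact_mod_cast this
  have h0 : (0 : ℝ) ≤ a := by exact_mod_cast ha
  have h1 : (a : ℝ) + 1 ≤ m := by exact_mod_cast ham
  have hset : {x : ℝ | ⌊m * x⌋ = a} = Ico (a / m : ℝ) ((a + 1) / m) := by
    ext x
    simp only [Set.mem_ofPred_eq, Int.floor_eq_iff, mem_Ico, div_le_iff₀ hm, lt_div_iff₀ hm,
      mul_comm x]
  have hsub : Ico (a / m : ℝ) ((a + 1) / m) ⊆ Icc 0 1 := fun x hx =>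
    ⟨(div_nonneg h0 hm.le).trans hx.1, hx.2.le.trans ((div_le_one hm).2 h1)⟩
  rw [hset, uniformInterval, Measure.restrict_apply measurableSet_Ico,
    inter_eq_self_of_subset_left hsub, Real.volume_Ico]
  congr 1
  ring

theorem measurable_gridCell (m : ℕ) : Measurable (gridCell m) := by
  refine Measurable.prodMk ?_ ?_ <;> exact Int.measurable_floor.comp (by fun_prop)

theorem uniformSquare_gridCell {m : ℕ} {a : ℤ × ℤ} (h1 : a.1 ∈ Ico (0 : ℤ) m)
    (h2 : a.2 ∈ Ico (0 : ℤ) m) :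
    uniformSquare {x | gridCell m x = a} = ENNReal.ofReal (1 / m ^ 2) := by
  have hmeas : ∀ a : ℤ, MeasurableSet {x : ℝ | ⌊m * x⌋ = a} := fun a =>
    (Int.measurable_floor.comp (by fun_prop : Measurable fun x : ℝ => m * x))
      (measurableSet_singleton a)
  have hset : {x | gridCell m x = a} = (fun x : TablePlane => (x 0, x 1)) ⁻¹'
      ({x : ℝ | ⌊m * x⌋ = a.1} ×ˢ {x : ℝ | ⌊m * x⌋ = a.2}) := by
    ext x
    simp [gridCell, Prod.ext_iff]
  rw [hset, measurePreserving_uniformSquare.measure_preimage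
    ((hmeas _).prod (hmeas _)).nullMeasurableSet, Measure.prod_prod,
    uniformInterval_floor h1.1 h1.2, uniformInterval_floor h2.1 h2.2,
    ← ENNReal.ofReal_mul (by positivity)]
  congr 1
  ring

theorem dist_le_sqrt_two_mul {x y : TablePlane} {δ : ℝ} (hδ : 0 ≤ δ)
    (h : ∀ i, |x i - y i| ≤ δ) : dist x y ≤ √2 * δ := by
  rw [EuclideanSpace.dist_eq, Fin.sum_univ_two, ← Real.sqrt_sq hδ, ← Real.sqrt_mul (by norm_num)]
  apply Real.sqrt_le_sqrt
  simp only [Real.dist_eq]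
  have h0 := pow_le_pow_left₀ (abs_nonneg _) (h 0) 2
  have h1 := pow_le_pow_left₀ (abs_nonneg _) (h 1) 2
  linarith

theorem dist_le_of_mem_unitSquare {x y : TablePlane} (hx : x ∈ unitSquare) (hy : y ∈ unitSquare) :
    dist x y ≤ √2 := by
  have := dist_le_sqrt_two_mul (x := x) (y := y) zero_le_one fun i =>
    abs_sub_le_iff.2 ⟨by linarith [(hx i).2, (hy i).1], by linarith [(hy i).2, (hx i).1]⟩
  rwa [mul_one] at this

theorem dist_le_of_gridCell_eq {m : ℕ} (hm : 0 < m) {x y : TablePlane}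
    (h : gridCell m x = gridCell m y) : dist x y ≤ √2 / m := by
  have hm' : (0 : ℝ) < m := by exact_mod_cast hm
  have key : ∀ s t : ℝ, ⌊m * s⌋ = ⌊m * t⌋ → |s - t| ≤ 1 / m := by
    intro s t hst
    have := Int.abs_sub_lt_one_of_floor_eq_floor hst
    rw [← mul_sub, abs_mul, abs_of_pos hm'] at this
    rw [le_div_iff₀ hm']
    linarith
  rw [gridCell, gridCell, Prod.mk.injEq] at h
  have := dist_le_sqrt_two_mul (x := x) (y := y) (δ := 1 / m) (by positivity)
    (Fin.forall_fin_two.2 ⟨key _ _ h.1, key _ _ h.2⟩)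
  rwa [mul_one_div] at this

/-! ### Concentration for independent objects -/

/-- The law of a random instance without the conditioning. -/
noncomputable abbrev iidInstance (n : ℕ) : Measure (Instance n) :=
  Measure.pi fun _ : Fin n => uniformSquare.prod uniformSquare

/-- Hoeffding's inequality for values in an interval of length `2 * B`. The rate precedes the
quantifiers over `ν` and `f`, so that one rate serves all the observables. -/
theorem exists_hoeffding_rate {δ B : ℝ} (hδ : 0 < δ) (hB : 0 < B) :
    ∃ c > 0, ∀ {Z : Type} [MeasurableSpace Z] (ν : Measure Z) [IsProbabilityMeasure ν] (f : Z → ℝ),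
      Measurable f → (∀ᵐ z ∂ν, f z ∈ Icc (-B) B) → ∀ n : ℕ,
      (Measure.pi fun _ : Fin n => ν) {ω | δ * n ≤ ∑ i, (f (ω i) - ∫ z, f z ∂ν)} ≤
        ENNReal.ofReal (Real.exp (-(c * n))) := by
  refine ⟨δ ^ 2 / (2 * B ^ 2), by positivity, ?_⟩
  intro Z _ ν _ f hf hfB n
  have hind : iIndepFun (fun (i : Fin n) (ω : Fin n → Z) => f (ω i) - ∫ z, f z ∂ν)
      (Measure.pi fun _ : Fin n => ν) :=
    iIndepFun_pi (X := fun _ z => f z - ∫ z, f z ∂ν) fun _ => (hf.sub_const _).aemeasurable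
  have hsub : ∀ i ∈ (Finset.univ : Finset (Fin n)),
      HasSubgaussianMGF (fun ω : Fin n → Z => f (ω i) - ∫ z, f z ∂ν)
        ((‖B - -B‖₊ / 2) ^ 2) (Measure.pi fun _ : Fin n => ν) := by
    intro i _
    have hmp := measurePreserving_eval (fun _ : Fin n => ν) i
    have h1 := hasSubgaussianMGF_of_mem_Icc (X := fun ω : Fin n → Z => f (ω i))
      (μ := Measure.pi fun _ : Fin n => ν) (a := -B) (b := B)
      (hf.comp hmp.measurable).aemeasurable (hmp.quasiMeasurePreserving.ae hfB)
    have h2 : ∫ ω, f (ω i) ∂(Measure.pi fun _ : Fin n => ν) = ∫ z, f z ∂ν := by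
      conv_rhs => rw [← hmp.map_eq]
      exact (integral_map hmp.measurable.aemeasurable hf.aestronglyMeasurable).symm
    rwa [h2] at h1
  have h := HasSubgaussianMGF.measure_sum_ge_le_of_iIndepFun hind hsub (ε := δ * n) (by positivity)
  rw [← ENNReal.ofReal_toReal (measure_ne_top _ _)]
  refine ENNReal.ofReal_le_ofReal (h.trans (Real.exp_le_exp.2 (le_of_eq ?_)))
  have hBB : ‖B - -B‖ = 2 * B := by rw [Real.norm_of_nonneg (by linarith)]; ring
  rcases Nat.eq_zero_or_pos n with rfl | hn
  · simp
  · simp only [Finset.sum_const, Finset.card_univ, Fintype.card_fin, nsmul_eq_mul]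
    push_cast
    rw [hBB]
    have : (0 : ℝ) < n := by exact_mod_cast hn
    field_simp

/-! ### Probability of being non-overlapping -/

theorem measurable_start {n : ℕ} (i : Fin n) : Measurable fun ω : Instance n => ω.start i :=
  measurable_fst.comp (measurable_pi_apply i)

theorem measurable_goal {n : ℕ} (i : Fin n) : Measurable fun ω : Instance n => ω.goal i :=
  measurable_snd.comp (measurable_pi_apply i)

theorem measurableSet_nonOverlapping (n : ℕ) (ρ : ℝ) :
    MeasurableSet {ω : Instance n | NonOverlapping ρ ω} := by
  have hs := measurable_start (n := n)
  have hg := measurable_goal (n := n)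
  have h1 : MeasurableSet {ω : Instance n |
      ∀ i j, i ≠ j → 2 * ρ < dist (ω.start i) (ω.start j)} := by
    simp only [Set.ofPred_forall]
    exact MeasurableSet.iInter fun i => MeasurableSet.iInter fun j => MeasurableSet.iInter fun _ =>
      measurableSet_lt measurable_const ((hs i).dist (hs j))
  have h2 : MeasurableSet {ω : Instance n |
      ∀ i j, i ≠ j → 2 * ρ < dist (ω.goal i) (ω.goal j)} := by
    simp only [Set.ofPred_forall]
    exact MeasurableSet.iInter fun i => MeasurableSet.iInter fun j => MeasurableSet.iInter fun _ =>
      measurableSet_lt measurable_const ((hg i).dist (hg j))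
  have h3 : MeasurableSet {ω : Instance n | ∀ i j, 2 * ρ < dist (ω.start i) (ω.goal j)} := by
    simp only [Set.ofPred_forall]
    exact MeasurableSet.iInter fun i => MeasurableSet.iInter fun j =>
      measurableSet_lt measurable_const ((hs i).dist (hg j))
  exact h1.inter (h2.inter h3)

theorem uniformSquare_closedBall_le (x : TablePlane) {ρ : ℝ} (hρ : 0 ≤ ρ) :
    uniformSquare (Metric.closedBall x (2 * ρ)) ≤ ENNReal.ofReal (4 * Real.pi * ρ ^ 2) := by
  refine (Measure.restrict_apply_le _ _).trans ?_
  rw [EuclideanSpace.volume_closedBall_fin_two, ← ENNReal.ofReal_pow (by positivity)]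
  rw [← ENNReal.ofReal_mul (by positivity)]
  refine ENNReal.ofReal_le_ofReal (le_of_eq ?_)
  ring

/-- The positions of a further object that overlap with an instance or with each other. -/
def overlapSet {n : ℕ} (ρ : ℝ) (ω : Instance n) : Set (TablePlane × TablePlane) :=
  {p | dist p.1 p.2 ≤ 2 * ρ} ∪
    ⋃ i, ((Metric.closedBall (ω.start i) (2 * ρ) ∪ Metric.closedBall (ω.goal i) (2 * ρ)) ×ˢ univ) ∪
      (univ ×ˢ (Metric.closedBall (ω.start i) (2 * ρ) ∪ Metric.closedBall (ω.goal i) (2 * ρ)))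

theorem measurableSet_overlapSet {n : ℕ} (ρ : ℝ) (ω : Instance n) :
    MeasurableSet (overlapSet ρ ω) := by
  have hball : ∀ x : TablePlane, MeasurableSet (Metric.closedBall x (2 * ρ)) := fun x =>
    Metric.isClosed_closedBall.measurableSet
  exact (measurableSet_le (by fun_prop) measurable_const).union (MeasurableSet.iUnion fun i =>
    (((hball _).union (hball _)).prod MeasurableSet.univ).union
      (MeasurableSet.univ.prod ((hball _).union (hball _))))

/-- Union bound: each earlier object contributes two forbidden discs for each of the two new points,
and the new start and goal must avoid each other. -/
theorem overlapSet_le {n : ℕ} {ρ : ℝ} (hρ : 0 ≤ ρ) (ω : Instance n) :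
    (uniformSquare.prod uniformSquare) (overlapSet ρ ω) ≤
      (4 * n + 1) * ENNReal.ofReal (4 * Real.pi * ρ ^ 2) := by
  set β := ENNReal.ofReal (4 * Real.pi * ρ ^ 2)
  have hball : ∀ x, uniformSquare (Metric.closedBall x (2 * ρ)) ≤ β := fun x =>
    uniformSquare_closedBall_le x hρ
  have h1 : (uniformSquare.prod uniformSquare) {p | dist p.1 p.2 ≤ 2 * ρ} ≤ β := by
    rw [Measure.prod_apply_symm (measurableSet_le (by fun_prop) measurable_const)]
    calc _ ≤ ∫⁻ _ : TablePlane, β ∂uniformSquare := lintegral_mono fun y => hball y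
      _ = β := by simp
  have h2 : ∀ i, uniformSquare (Metric.closedBall (ω.start i) (2 * ρ) ∪
      Metric.closedBall (ω.goal i) (2 * ρ)) ≤ 2 * β := fun i =>
    (measure_union_le _ _).trans ((add_le_add (hball _) (hball _)).trans (two_mul β).ge)
  have h3 : ∀ i, (uniformSquare.prod uniformSquare)
      (((Metric.closedBall (ω.start i) (2 * ρ) ∪ Metric.closedBall (ω.goal i) (2 * ρ)) ×ˢ univ) ∪
      (univ ×ˢ (Metric.closedBall (ω.start i) (2 * ρ) ∪ Metric.closedBall (ω.goal i) (2 * ρ)))) ≤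
      4 * β := by
    intro i
    refine (measure_union_le _ _).trans ?_
    rw [Measure.prod_prod, Measure.prod_prod, measure_univ, mul_one, one_mul]
    refine (add_le_add (h2 i) (h2 i)).trans (le_of_eq ?_)
    ring
  refine (measure_union_le _ _).trans ?_
  refine (add_le_add h1 ((measure_iUnion_fintype_le _ _).trans (Finset.sum_le_sum fun i _ => h3 i))).trans
    (le_of_eq ?_)
  simp only [Finset.sum_const, Finset.card_univ, Fintype.card_fin, nsmul_eq_mul]
  ring

theorem nonOverlapping_cons {n : ℕ} {ρ : ℝ} {ω : Instance (n + 1)}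
    (htail : NonOverlapping ρ (fun i : Fin n => ω i.succ : Instance n))
    (h0 : ω 0 ∉ overlapSet ρ (fun i : Fin n => ω i.succ : Instance n)) : NonOverlapping ρ ω := by
  simp only [overlapSet, mem_union, mem_iUnion, mem_prod, Set.mem_ofPred_eq, mem_univ, and_true,
    true_and, Metric.mem_closedBall, not_or, not_exists, not_le] at h0
  obtain ⟨hsg, h⟩ := h0
  obtain ⟨h1, h2, h3⟩ := htail
  have hs := fun i => (h i).1.1
  have hg := fun i => (h i).1.2
  have hs' := fun i => (h i).2.1
  have hg' := fun i => (h i).2.2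
  simp only [Instance.start, Instance.goal] at *
  refine ⟨fun i j hij => ?_, fun i j hij => ?_, fun i j => ?_⟩ <;>
    rcases Fin.eq_zero_or_eq_succ i with rfl | ⟨i, rfl⟩ <;>
    rcases Fin.eq_zero_or_eq_succ j with rfl | ⟨j, rfl⟩
  · exact absurd rfl hij
  · exact hs j
  · rw [dist_comm]
    exact hs i
  · exact h1 i j fun e => hij (e ▸ rfl)
  · exact absurd rfl hij
  · exact hg' j
  · rw [dist_comm]
    exact hg' i
  · exact h2 i j fun e => hij (e ▸ rfl)
  · exact hsg
  · exact hg j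
  · rw [dist_comm]
    exact hs' i
  · exact h3 i j

theorem measurableSet_overlapSet_graph (n : ℕ) (ρ : ℝ) :
    MeasurableSet {q : (TablePlane × TablePlane) × Instance n | q.1 ∈ overlapSet ρ q.2} := by
  have hs : ∀ i, Measurable fun q : (TablePlane × TablePlane) × Instance n => q.2.start i :=
    fun i => (measurable_start i).comp measurable_snd
  have hg : ∀ i, Measurable fun q : (TablePlane × TablePlane) × Instance n => q.2.goal i :=
    fun i => (measurable_goal i).comp measurable_snd
  have h1 : Measurable fun q : (TablePlane × TablePlane) × Instance n => q.1.1 :=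
    measurable_fst.comp measurable_fst
  have h2 : Measurable fun q : (TablePlane × TablePlane) × Instance n => q.1.2 :=
    measurable_snd.comp measurable_fst
  have hle : ∀ {f g : (TablePlane × TablePlane) × Instance n → TablePlane}, Measurable f →
      Measurable g → MeasurableSet {q | dist (f q) (g q) ≤ 2 * ρ} := fun hf hg =>
    measurableSet_le (hf.dist hg) measurable_const
  have hset : {q : (TablePlane × TablePlane) × Instance n | q.1 ∈ overlapSet ρ q.2} =
      {q | dist q.1.1 q.1.2 ≤ 2 * ρ} ∪
      ⋃ i, ({q | dist q.1.1 (q.2.start i) ≤ 2 * ρ} ∪ {q | dist q.1.1 (q.2.goal i) ≤ 2 * ρ}) ∪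
        ({q | dist q.1.2 (q.2.start i) ≤ 2 * ρ} ∪ {q | dist q.1.2 (q.2.goal i) ≤ 2 * ρ}) := by
    ext q
    simp [overlapSet]
  rw [hset]
  exact (hle h1 h2).union (MeasurableSet.iUnion fun i =>
    ((hle h1 (hs i)).union (hle h1 (hg i))).union ((hle h2 (hs i)).union (hle h2 (hg i))))

theorem mul_measure_le_prod {α β : Type*} [MeasurableSpace α] [MeasurableSpace β] (μ : Measure α)
    (ν : Measure β) [SFinite μ] [SFinite ν] {s : Set (α × β)} (hs : MeasurableSet s) {t : Set β}
    (ht : MeasurableSet t) {c : ℝ≥0∞} (h : ∀ y ∈ t, c ≤ μ ((fun x => (x, y)) ⁻¹' s)) :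
    c * ν t ≤ (μ.prod ν) s := by
  rw [Measure.prod_apply_symm hs, ← setLIntegral_const]
  exact (setLIntegral_mono' ht h).trans (setLIntegral_le_lintegral _ _)

/-- Placing the objects one after the other bounds the probability of being non-overlapping. -/
theorem pow_le_iidInstance_nonOverlapping {ρ : ℝ} (hρ : 0 ≤ ρ) {N k : ℕ} (hk : k ≤ N) :
    (1 - (4 * N + 1) * ENNReal.ofReal (4 * Real.pi * ρ ^ 2)) ^ k ≤
      iidInstance k {ω | NonOverlapping ρ ω} := by
  set b := (4 * N + 1) * ENNReal.ofReal (4 * Real.pi * ρ ^ 2) with hb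
  induction k with
  | zero =>
    have : {ω : Instance 0 | NonOverlapping ρ ω} = univ := by
      ext ω
      simp [NonOverlapping]
    rw [this, measure_univ, pow_zero]
  | succ k ih =>
    specialize ih (by omega)
    have hmp := measurePreserving_piFinSuccAbove
      (fun _ : Fin (k + 1) => uniformSquare.prod uniformSquare) 0
    -- The first object is placed outside the overlap set of the other `k`, whose measure is bounded
    -- uniformly through `N`; this yields one factor `1 - b`.
    set s : Set ((TablePlane × TablePlane) × Instance k) :=
      {q | NonOverlapping ρ q.2} ∩ {q | q.1 ∈ overlapSet ρ q.2}ᶜ with hs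
    have hms : MeasurableSet s :=
      ((measurableSet_nonOverlapping k ρ).preimage measurable_snd).inter
        (measurableSet_overlapSet_graph k ρ).compl
    have hsub : (MeasurableEquiv.piFinSuccAbove (fun _ => TablePlane × TablePlane) 0) ⁻¹' s ⊆
        {ω : Instance (k + 1) | NonOverlapping ρ ω} := by
      intro ω hω
      have e : MeasurableEquiv.piFinSuccAbove (fun _ => TablePlane × TablePlane) 0 ω =
          (ω 0, fun i : Fin k => ω i.succ) := rfl
      rw [mem_preimage, e] at hω
      exact nonOverlapping_cons hω.1 hω.2
    refine le_trans ?_ (measure_mono hsub)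
    rw [hmp.measure_preimage hms.nullMeasurableSet, pow_succ']
    refine (mul_le_mul_right ih (1 - b)).trans ?_
    refine mul_measure_le_prod _ (iidInstance k) hms (measurableSet_nonOverlapping k ρ)
      fun ω hω => ?_
    replace hω : NonOverlapping ρ ω := hω
    have hpre : (fun x : TablePlane × TablePlane => (x, ω)) ⁻¹' s = (overlapSet ρ ω)ᶜ := by
      ext x
      simp only [hs, mem_preimage, mem_inter_iff, Set.mem_ofPred_eq, mem_compl_iff, hω, true_and]
    rw [hpre, prob_compl_eq_one_sub (measurableSet_overlapSet ρ ω)]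
    refine tsub_le_tsub_left ((overlapSet_le hρ ω).trans ?_) 1
    rw [hb]
    gcongr
    omega

/-! ### Typical instances -/

theorem meanSegmentLength_pos : 0 < meanSegmentLength := by
  have h : 0 ≤ Real.log (1 + √2) := Real.log_nonneg (by linarith [Real.sqrt_nonneg 2])
  have := Real.sqrt_nonneg 2
  unfold meanSegmentLength
  positivity

/-- The pairs of cells of the `m × m` grid. -/
noncomputable def gridPairs (m : ℕ) : Finset ((ℤ × ℤ) × (ℤ × ℤ)) :=
  (Finset.Ico 0 (m : ℤ) ×ˢ Finset.Ico 0 (m : ℤ)) ×ˢ (Finset.Ico 0 (m : ℤ) ×ˢ Finset.Ico 0 (m : ℤ))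

theorem card_gridPairs (m : ℕ) : (gridPairs m).card = m ^ 4 := by
  simp [gridPairs]
  ring

theorem swap_mem_gridPairs {m : ℕ} {t : (ℤ × ℤ) × (ℤ × ℤ)} (ht : t ∈ gridPairs m) :
    t.swap ∈ gridPairs m := by
  rw [gridPairs, Finset.mem_product] at *
  exact ⟨ht.2, ht.1⟩

/-- The cells of the start and of the goal of an object. -/
noncomputable def gridType {n : ℕ} (m : ℕ) (ω : Instance n) (i : Fin n) : (ℤ × ℤ) × (ℤ × ℤ) :=
  (gridCell m (ω.start i), gridCell m (ω.goal i))

/-- Up to an error `δ`, the average transfer length and the frequencies of the pairs of grid cells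
are at least what is expected. -/
structure TypicalInstance {n : ℕ} (m : ℕ) (δ : ℝ) (ω : Instance n) : Prop where
  start_mem : ∀ i, ω.start i ∈ unitSquare
  goal_mem : ∀ i, ω.goal i ∈ unitSquare
  abs_sum_sub_le : |∑ i, dist (ω.start i) (ω.goal i) - n * meanSegmentLength| ≤ δ * n
  le_card : ∀ t ∈ gridPairs m, n * (1 / (m : ℝ) ^ 4 - δ) ≤ Fintype.card {i // gridType m ω i = t}

theorem ae_mem_unitSquare :
    ∀ᵐ p ∂(uniformSquare.prod uniformSquare), p.1 ∈ unitSquare ∧ p.2 ∈ unitSquare := by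
  have h : ∀ᵐ x ∂uniformSquare, x ∈ unitSquare := ae_restrict_mem measurableSet_unitSquare
  exact (Measure.quasiMeasurePreserving_fst.ae h).and (Measure.quasiMeasurePreserving_snd.ae h)

theorem measurableSet_gridType (m : ℕ) (t : (ℤ × ℤ) × (ℤ × ℤ)) :
    MeasurableSet {p : TablePlane × TablePlane | (gridCell m p.1, gridCell m p.2) = t} :=
  (((measurable_gridCell m).comp measurable_fst).prodMk
    ((measurable_gridCell m).comp measurable_snd)) (measurableSet_singleton t)

theorem integral_gridType {m : ℕ} {t : (ℤ × ℤ) × (ℤ × ℤ)} (ht : t ∈ gridPairs m) :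
    ∫ p : TablePlane × TablePlane, -(if (gridCell m p.1, gridCell m p.2) = t then (1 : ℝ) else 0)
      ∂(uniformSquare.prod uniformSquare) = -(1 / (m : ℝ) ^ 4) := by
  simp only [gridPairs, Finset.mem_product, Finset.mem_Ico] at ht
  have h1 : (fun p : TablePlane × TablePlane =>
      if (gridCell m p.1, gridCell m p.2) = t then (1 : ℝ) else 0) =
      {p : TablePlane × TablePlane | (gridCell m p.1, gridCell m p.2) = t}.indicator 1 := by
    ext p
    simp [Set.indicator]
  have h2 : {p : TablePlane × TablePlane | (gridCell m p.1, gridCell m p.2) = t} =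
      {x | gridCell m x = t.1} ×ˢ {x | gridCell m x = t.2} := by
    ext p
    simp [Prod.ext_iff]
  rw [integral_neg, h1, integral_indicator_one (measurableSet_gridType m t), h2, Measure.real,
    Measure.prod_prod, uniformSquare_gridCell ht.1.1 ht.1.2, uniformSquare_gridCell ht.2.1 ht.2.2,
    ENNReal.toReal_mul, ENNReal.toReal_ofReal (by positivity)]
  ring

/-- Union bound over the two tails of the transfer length and the lower tail of each of the finitely
many pair counts. The points lie in the square almost surely. -/
theorem exists_typical_rate (m : ℕ) {δ : ℝ} (hδ : 0 < δ) :
    ∃ c > 0, ∃ A : ℕ, ∀ n, iidInstance n {ω | ¬ TypicalInstance m δ ω} ≤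
      A * ENNReal.ofReal (Real.exp (-(c * n))) := by
  obtain ⟨c, hc, h⟩ := exists_hoeffding_rate hδ (zero_lt_two' ℝ)
  refine ⟨c, hc, 2 + (gridPairs m).card, fun n => ?_⟩
  set ν := uniformSquare.prod uniformSquare
  set e := ENNReal.ofReal (Real.exp (-(c * n)))
  have hdist : ∀ᵐ p ∂ν, dist p.1 p.2 ∈ Icc (0 : ℝ) 2 := by
    filter_upwards [ae_mem_unitSquare] with p hp
    exact ⟨dist_nonneg, (dist_le_of_mem_unitSquare hp.1 hp.2).trans
      (by rw [Real.sqrt_le_left] <;> norm_num)⟩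
  have h1 := h ν (fun p => dist p.1 p.2) (by fun_prop) (by
    filter_upwards [hdist] with p hp using ⟨by linarith [hp.1], hp.2⟩) n
  have h2 := h ν (fun p => -dist p.1 p.2) (by fun_prop) (by
    filter_upwards [hdist] with p hp using ⟨by linarith [hp.2], by linarith [hp.1]⟩) n
  -- The sign turns the upper tail bound into one for too few objects of a type.
  have h3 := fun t => h ν
    (fun p => -(if (gridCell m p.1, gridCell m p.2) = t then (1 : ℝ) else 0))
    (Measurable.ite (measurableSet_gridType m t) measurable_const measurable_const).neg
    (Eventually.of_forall fun p => by split_ifs <;> norm_num) n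
  have h4 : iidInstance n {ω | ¬ ∀ i, (ω i).1 ∈ unitSquare ∧ (ω i).2 ∈ unitSquare} = 0 := by
    have : ∀ᵐ ω ∂(iidInstance n), ∀ i, (ω i).1 ∈ unitSquare ∧ (ω i).2 ∈ unitSquare :=
      ae_all_iff.2 fun i => (measurePreserving_eval (fun _ : Fin n => ν)
        i).quasiMeasurePreserving.ae ae_mem_unitSquare
    exact this
  rw [integral_neg] at h2
  rw [integral_dist_uniformSquare] at h1 h2
  set U₀ := {ω : Instance n | ¬ ∀ i, (ω i).1 ∈ unitSquare ∧ (ω i).2 ∈ unitSquare}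
  set U₁ := {ω : Instance n | δ * n ≤ ∑ i, (dist (ω i).1 (ω i).2 - meanSegmentLength)}
  set U₂ := {ω : Instance n | δ * n ≤ ∑ i, (-dist (ω i).1 (ω i).2 - -meanSegmentLength)}
  set V : (ℤ × ℤ) × (ℤ × ℤ) → Set (Instance n) := fun t =>
    {ω : Instance n | δ * n ≤ ∑ i,
      (-(if (gridCell m (ω i).1, gridCell m (ω i).2) = t then (1 : ℝ) else 0) -
        ∫ p : TablePlane × TablePlane, -(if (gridCell m p.1, gridCell m p.2) = t then (1 : ℝ) else 0)
          ∂ν)}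
  have hsub : {ω : Instance n | ¬ TypicalInstance m δ ω} ⊆
      (U₀ ∪ (U₁ ∪ U₂)) ∪ ⋃ t ∈ gridPairs m, V t := by
    intro ω hω
    by_contra hcon
    simp only [mem_union, mem_iUnion, not_or, not_exists] at hcon
    obtain ⟨⟨hu0, hu1, hu2⟩, hv⟩ := hcon
    simp only [U₀, U₁, U₂, V, Set.mem_ofPred_eq, not_not, not_le, Finset.sum_sub_distrib,
      Finset.sum_neg_distrib, Finset.sum_const, Finset.card_univ, Fintype.card_fin, nsmul_eq_mul]
      at hu0 hu1 hu2 hv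
    refine hω ⟨fun i => (hu0 i).1, fun i => (hu0 i).2, abs_le.2 ⟨?_, hu1.le⟩, fun t ht => ?_⟩
    · simp only [Instance.start, Instance.goal]
      linarith
    · have := hv t ht
      rw [integral_gridType ht] at this
      have hcount : (Fintype.card {i // gridType m ω i = t} : ℝ) =
          ∑ i, if (gridCell m (ω i).1, gridCell m (ω i).2) = t then (1 : ℝ) else 0 := by
        rw [Finset.sum_boole, Fintype.card_subtype]
        rfl
      rw [hcount]
      linarith
  refine (measure_mono hsub).trans ?_
  refine (measure_union_le _ _).trans ?_
  calc iidInstance n (U₀ ∪ (U₁ ∪ U₂)) + iidInstance n (⋃ t ∈ gridPairs m, V t)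
      ≤ (0 + (e + e)) + ∑ t ∈ gridPairs m, e := by
        refine add_le_add ?_ ((measure_biUnion_finset_le _ _).trans
          (Finset.sum_le_sum fun t _ => h3 t))
        refine (measure_union_le _ _).trans (add_le_add h4.le ?_)
        exact (measure_union_le _ _).trans (add_le_add h1 h2)
    _ = _ := by
        rw [Finset.sum_const, nsmul_eq_mul]
        push_cast
        ring

/-- What typical instances satisfy, with an error `η` per object. -/
theorem TypicalInstance.bounds {n m : ℕ} {δ η cp cd ct r : ℝ} {ω : Instance n}
    (hω : TypicalInstance m δ ω) (hcp : 0 ≤ cp) (hcd : 0 ≤ cd) (hct : 0 < ct) (hr : 0 ≤ r)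
    (hn : 0 < n) (hm : 0 < m) (hmη : √2 / m ≤ η) (hδη : δ * m ^ 4 ≤ η)
    (hδ1 : δ * m ^ 4 ≤ 1) (hnη : 4 * (m : ℝ) ^ 4 ≤ η * n) :
    (⨅ σ : Equiv.Perm (Fin n), ∑ j, dist (ω.goal (σ j)) (ω.start (σ (finRotate n j)))) ≤
        6 * η * n ∧
      ∃ P : TwoArmPlan ω cp cd ct r,
        P.makespan ≤ (n / 2 + η * n) * (cp + cd + 16 * r * ct) +
          ct * ((∑ i, dist (ω.start i) (ω.goal i)) / 2 + η * n + 5 * (η * n) * (2 + 2 * r)) := by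
  have hm' : (0 : ℝ) < m := by exact_mod_cast hm
  have hn' : (0 : ℝ) < n := by exact_mod_cast hn
  set Q := m ^ 4 with hQ
  have hQc : ((Q : ℕ) : ℝ) = (m : ℝ) ^ 4 := by rw [hQ]; push_cast; ring
  have hQ0 : (0 : ℝ) < Q := by rw [hQc]; positivity
  rw [← hQc] at hδη hδ1 hnη
  set x : ℝ := n * (1 / Q - δ) with hx
  have hx0 : 0 ≤ x := by
    have : δ ≤ 1 / Q := (le_div_iff₀ hQ0).2 hδ1
    exact mul_nonneg hn'.le (by linarith)
  -- `x` is the guaranteed number of objects of each type, and the pattern uses each type at most `4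
  -- * M` times.
  set M := ⌊x / 4⌋₊ with hM
  have hMx : 4 * (M : ℝ) ≤ x := by
    have := Nat.floor_le (show 0 ≤ x / 4 by positivity)
    linarith
  have hxM : x < 4 * M + 4 := by
    have := Nat.lt_floor_add_one (x / 4)
    linarith
  let E : gridPairs m ≃ Fin Q := (gridPairs m).equivFinOfCardEq (card_gridPairs m)
  let pr : ℕ → (ℤ × ℤ) × (ℤ × ℤ) := fun p => if h : p < Q then (E.symm ⟨p, h⟩).1 else 0
  have hpr : ∀ p (h : p < Q), pr p = (E.symm ⟨p, h⟩).1 := fun p h => dif_pos h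
  have hcard : ∀ p < Q, 4 * M ≤ Fintype.card {i // gridType m ω i = pr p} := by
    intro p hp
    have h1 := hω.le_card (pr p) (by rw [hpr p hp]; exact (E.symm ⟨p, hp⟩).2)
    rw [← hQc] at h1
    have h2 : ((4 * M : ℕ) : ℝ) ≤ Fintype.card {i // gridType m ω i = pr p} := by
      push_cast
      exact hMx.trans h1
    exact_mod_cast h2
  obtain ⟨hle, σ, hσ⟩ := exists_perm_cellPattern (M := M) (gridType m ω) pr
    (fun p hp q hq hpq => by
      rw [hpr p hp, hpr q hq] at hpq
      simpa using E.symm.injective (Subtype.ext hpq))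
    (fun p hp => by
      have hmem : (pr p).swap ∈ gridPairs m :=
        swap_mem_gridPairs (by rw [hpr p hp]; exact (E.symm ⟨p, hp⟩).2)
      refine ⟨E ⟨_, hmem⟩, (E ⟨_, hmem⟩).2, ?_⟩
      rw [hpr _ (E ⟨_, hmem⟩).2, Fin.eta, Equiv.symm_apply_apply]) hcard
  have hR0 : (0 : ℝ) ≤ n - 4 * M * Q := by
    have : ((4 * M * Q : ℕ) : ℝ) ≤ n := by exact_mod_cast hle
    push_cast at this
    linarith
  -- The objects left over come from the deviation `δ` in the counts and from rounding, which loses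
  -- fewer than four objects of each of the `Q` types; each source is at most `η * n`.
  have hR : (n : ℝ) - 4 * M * Q ≤ 2 * (η * n) := by
    have h1 : x * Q ≤ (4 * M + 4) * Q := by gcongr
    have h2 : x * Q = n - n * (δ * Q) := by
      rw [hx]
      field_simp
    have h3 : n * (δ * Q) ≤ n * η := by gcongr
    linarith
  have hS2 : √2 ≤ 3 / 2 := by
    rw [Real.sqrt_le_left (by norm_num)]
    norm_num
  have hη : 0 ≤ η * n := le_trans (by positivity) hnη
  have hnD : n * (√2 / m) ≤ η * n := by
    rw [mul_comm]
    gcongr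
  have hS : 0 ≤ √2 := Real.sqrt_nonneg 2
  have hDist : ∀ i j, dist (ω.goal i) (ω.start j) ≤ √2 := fun i j =>
    dist_le_of_mem_unitSquare (hω.goal_mem i) (hω.start_mem j)
  have hcell : ∀ i j, gridCell m (ω.goal i) = gridCell m (ω.start j) →
      dist (ω.goal i) (ω.start j) ≤ √2 / m := fun i j h => dist_le_of_gridCell_eq hm h
  refine ⟨(iInf_transit_le (by positivity) hS hDist hcell hle hσ).trans ?_, ?_⟩
  · have h1 : (2 * (Q : ℝ) + (n - 4 * M * Q)) * √2 ≤ (3 * (η * n)) * (3 / 2) := by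
      gcongr
      linarith
    linarith
  · obtain ⟨P, hP⟩ := exists_plan_le (r := r) hcp hcd hct hr hn (by positivity) hS hDist hcell
      (fun i j h1 h2 => by
        have e1 := dist_le_of_gridCell_eq hm h1
        have e2 := dist_le_of_gridCell_eq hm h2.symm
        have := dist_triangle4 (ω.start i) (ω.start j) (ω.goal j) (ω.goal i)
        linarith) hle hσ
    refine ⟨P, hP.trans ?_⟩
    gcongr
    · linarith
    · linarith
    · linarith

/-- Only arithmetic remains. The cost per object lies between `c - ct * η` and `c + 7 * ct * η`,
where 7 is 1 from the transfers plus 6 from the transits. In `hη4` the term `12 * ct` covers 1/2 + 1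
+ 10 from the plan, and the last summand pays for replacing the cost by its lower bound. -/
theorem singleArmCost_and_makespan_bounds {n : ℕ} {cp cd ct r ε η : ℝ} {ω : Instance n} (hcp : 0 ≤ cp)
    (hcd : 0 ≤ cd) (hct : 0 < ct) (hr : 0 ≤ r) (hε : 0 < ε) (hn : 0 < n) (hη : 0 < η)
    (hsum : |∑ i, dist (ω.start i) (ω.goal i) - n * meanSegmentLength| ≤ η * n)
    (htransit : (⨅ σ : Equiv.Perm (Fin n), ∑ j, dist (ω.goal (σ j)) (ω.start (σ (finRotate n j)))) ≤
        6 * η * n)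
    (hplan : ∃ P : TwoArmPlan ω cp cd ct r,
        P.makespan ≤ (n / 2 + η * n) * (cp + cd + 16 * r * ct) +
          ct * ((∑ i, dist (ω.start i) (ω.goal i)) / 2 + η * n + 5 * (η * n) * (2 + 2 * r)))
    (hη1 : 7 * ct * η ≤ ε) (hη2 : ct * η ≤ (cp + cd + meanSegmentLength * ct) / 2)
    (hη3 : 6 * ct * η ≤ ε * (cp + cd + meanSegmentLength * ct))
    (hη4 : (cp + cd + 16 * r * ct + ct * (12 + 10 * r) +
      (1 / 2 + 4 * Real.pi * r * ct / (cp + cd + meanSegmentLength * ct) + ε) * ct) * η ≤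
        ε * (cp + cd + meanSegmentLength * ct)) :
    |singleArmCost ω (cp + cd) ct / n - ((cp + cd) + meanSegmentLength * ct)| ≤ ε ∧
      (∃ P : TwoArmPlan ω cp cd ct r,
        P.makespan ≤
          (1 / 2 + 4 * Real.pi * r * ct / ((cp + cd) + meanSegmentLength * ct) + ε) *
            singleArmCost ω (cp + cd) ct) ∧
      (∀ P : TwoArmPlan ω cp cd ct r,
        (1 / 2 - ε) * singleArmCost ω (cp + cd) ct ≤ P.makespan) := by
  have hn' : (0 : ℝ) < n := by exact_mod_cast hn
  have hκ := meanSegmentLength_pos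
  set c := cp + cd + meanSegmentLength * ct with hc
  have hc0 : 0 < c := by positivity
  set Sd := ∑ i, dist (ω.start i) (ω.goal i) with hSd
  set tr := ⨅ σ : Equiv.Perm (Fin n), ∑ j, dist (ω.goal (σ j)) (ω.start (σ (finRotate n j))) with htr
  have htr0 : 0 ≤ tr := Real.iInf_nonneg fun σ => Finset.sum_nonneg fun _ _ => dist_nonneg
  have hC : singleArmCost ω (cp + cd) ct = n * (cp + cd) + ct * Sd + ct * tr := rfl
  set C := singleArmCost ω (cp + cd) ct with hCdef
  obtain ⟨hs1, hs2⟩ := abs_le.1 hsum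
  have hctS1 : ct * (n * meanSegmentLength - η * n) ≤ ct * Sd := by
    gcongr
    linarith
  have hctS2 : ct * Sd ≤ ct * (n * meanSegmentLength + η * n) := by
    gcongr
    linarith
  have hcttr : ct * tr ≤ ct * (6 * η * n) := by gcongr
  have hcttr0 : 0 ≤ ct * tr := by positivity
  have hnc : n * c = n * (cp + cd) + ct * (n * meanSegmentLength) := by
    rw [hc]
    ring
  have hClow : n * (c - ct * η) ≤ C := by
    rw [hC]
    linarith
  have hCup : C ≤ n * (c + 7 * ct * η) := by
    rw [hC]
    linarith
  have hChalf : n * (c / 2) ≤ C := by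
    refine le_trans ?_ hClow
    gcongr
    linarith
  refine ⟨?_, ?_, fun P => ?_⟩
  · have h0 : 0 ≤ n * (ct * η) := by positivity
    have h1 := mul_le_mul_of_nonneg_left hη1 hn'.le
    rw [abs_le]
    constructor
    · rw [neg_le_sub_iff_le_add, ← sub_le_iff_le_add, le_div_iff₀ hn']
      linarith
    · rw [sub_le_iff_le_add, div_le_iff₀ hn']
      linarith
  · obtain ⟨P, hP⟩ := hplan
    refine ⟨P, hP.trans ?_⟩
    set q := 4 * Real.pi * r * ct / c with hq
    have hqc : q * c = 4 * Real.pi * r * ct := by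
      rw [hq]
      field_simp
    have hq0 : 0 ≤ q := by positivity
    have hθ := mul_le_mul_of_nonneg_left hClow (by positivity : 0 ≤ 1 / 2 + q + ε)
    refine le_trans ?_ hθ
    have h4 := mul_le_mul_of_nonneg_left hη4 hn'.le
    -- About `n / 2` lockstep steps with delay `16 * r * ct` each fit into the allowed collision
    -- term.
    have hπ : 8 * (n * (r * ct)) ≤ 4 * Real.pi * r * ct * n := by
      have : 0 ≤ n * (r * ct) := by positivity
      nlinarith [Real.pi_gt_three]
    have e : (1 / 2 + q + ε) * (n * (c - ct * η)) =
        n * (c / 2) + n * (q * c) + n * (ε * c) - n * ((1 / 2 + q + ε) * ct * η) := by ring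
    rw [e, hqc]
    have h5 : 0 ≤ ct * (η * n) := by positivity
    linarith
  · have hlow := P.sum_transfer_le_two_mul_makespan hcp hcd
    rw [← hSd] at hlow
    have h1 : n * (6 * ct * η) ≤ n * (ε * c) := by gcongr
    have h2 : 2 * ε * (n * (c / 2)) ≤ 2 * ε * C := by gcongr
    linarith

/-! ### Passing to the conditional law -/

/-- The probability that a given further object overlaps with one of `n` objects tends to zero. -/
theorem tendsto_overlap {ρ : ℕ → ℝ}
    (hρ_area : Tendsto (fun n : ℕ => (n : ℝ) * ρ n ^ 2) atTop (𝓝 0)) :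
    Tendsto (fun n : ℕ => (4 * n + 1) * (4 * Real.pi * ρ n ^ 2)) atTop (𝓝 0) := by
  -- `4 * n + 1 ≤ 5 * n` for `n ≥ 1`, and 5 · 4 = 20.
  have h1 : Tendsto (fun n : ℕ => 20 * Real.pi * ((n : ℝ) * ρ n ^ 2)) atTop (𝓝 0) := by
    simpa using hρ_area.const_mul (20 * Real.pi)
  refine tendsto_of_tendsto_of_tendsto_of_le_of_le' tendsto_const_nhds h1
    (Eventually.of_forall fun n => by positivity) ?_
  filter_upwards [eventually_ge_atTop 1] with n hn
  have hn' : (1 : ℝ) ≤ n := by exact_mod_cast hn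
  have : 0 ≤ Real.pi * ρ n ^ 2 := by positivity
  nlinarith

/-- Each placement succeeds with probability tending to 1, hence eventually at least exp(-c), and
there are `n` placements. -/
theorem eventually_exp_le_iidInstance_nonOverlapping {ρ : ℕ → ℝ} (hρ : ∀ n, 0 ≤ ρ n)
    (hρ_area : Tendsto (fun n : ℕ => (n : ℝ) * ρ n ^ 2) atTop (𝓝 0)) {c : ℝ} (hc : 0 < c) :
    ∀ᶠ n : ℕ in atTop, ENNReal.ofReal (Real.exp (-(c * n))) ≤
      iidInstance n {ω | NonOverlapping (ρ n) ω} := by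
  have hpos : 0 < 1 - Real.exp (-c) := by
    have : Real.exp (-c) < 1 := by simpa using hc
    linarith
  filter_upwards [(tendsto_overlap hρ_area).eventually_le_const hpos] with n hn
  refine le_trans ?_ (pow_le_iidInstance_nonOverlapping (hρ n) le_rfl)
  have h1 : Real.exp (-(c * n)) = Real.exp (-c) ^ n := by
    rw [← Real.exp_nat_mul]
    congr 1
    ring
  rw [h1, ENNReal.ofReal_pow (Real.exp_pos _).le]
  gcongr
  have h2 : (4 * (n : ℝ≥0∞) + 1) * ENNReal.ofReal (4 * Real.pi * ρ n ^ 2) =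
      ENNReal.ofReal ((4 * n + 1) * (4 * Real.pi * ρ n ^ 2)) := by
    have h3 : ENNReal.ofReal (4 * n + 1) = 4 * n + 1 := by
      rw [ENNReal.ofReal_add (by positivity) zero_le_one, ENNReal.ofReal_mul (by norm_num)]
      simp
    rw [ENNReal.ofReal_mul (p := 4 * (n : ℝ) + 1) (by positivity), h3]
  rw [h2, ← ENNReal.ofReal_one, ← ENNReal.ofReal_sub _ (by positivity)]
  exact ENNReal.ofReal_le_ofReal (by linarith)

theorem randomInstance_le {n : ℕ} {ρ b : ℝ} (t : Set (Instance n)) (hb : 0 < b)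
    (h : ENNReal.ofReal b ≤ iidInstance n {ω | NonOverlapping ρ ω}) :
    randomInstance n ρ t ≤ ENNReal.ofReal b⁻¹ * iidInstance n t := by
  rw [randomInstance, cond_apply (measurableSet_nonOverlapping n ρ)]
  rw [ENNReal.ofReal_inv_of_pos hb]
  gcongr
  exact inter_subset_right

/-- Failure has probability O(exp(-cn)) without conditioning; dividing by at least exp(-cn/2) still
leaves exponential decay. -/
theorem tendsto_randomInstance_not_typical {ρ : ℕ → ℝ} (hρ : ∀ n, 0 ≤ ρ n)
    (hρ_area : Tendsto (fun n : ℕ => (n : ℝ) * ρ n ^ 2) atTop (𝓝 0)) (m : ℕ) {δ : ℝ}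
    (hδ : 0 < δ) :
    Tendsto (fun n => randomInstance n (ρ n) {ω | ¬ TypicalInstance m δ ω}) atTop (𝓝 0) := by
  obtain ⟨c, hc, A, hA⟩ := exists_typical_rate m hδ
  have hlim : Tendsto (fun n : ℕ => ENNReal.ofReal (A * Real.exp (-(c / 2 * n)))) atTop (𝓝 0) := by
    rw [← ENNReal.ofReal_zero]
    refine ENNReal.tendsto_ofReal ?_
    have h1 : Tendsto (fun n : ℕ => c / 2 * (n : ℝ)) atTop atTop :=
      tendsto_natCast_atTop_atTop.const_mul_atTop (by positivity)
    simpa using (Real.tendsto_exp_neg_atTop_nhds_zero.comp h1).const_mul (A : ℝ)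
  refine tendsto_of_tendsto_of_tendsto_of_le_of_le' tendsto_const_nhds hlim
    (Eventually.of_forall fun _ => zero_le) ?_
  filter_upwards [eventually_exp_le_iidInstance_nonOverlapping hρ hρ_area (half_pos hc)] with n hn
  refine (randomInstance_le _ (Real.exp_pos _) hn).trans ?_
  refine (mul_le_mul_right (hA n) _).trans (le_of_eq ?_)
  rw [← ENNReal.ofReal_natCast, ← ENNReal.ofReal_mul (by positivity),
    ← ENNReal.ofReal_mul (by positivity), ← Real.exp_neg]
  congr 1
  rw [mul_left_comm, ← Real.exp_add]
  congr 2
  ring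

theorem exists_pos_mul_le {X Y : ℝ} (hX : 0 ≤ X) (hY : 0 < Y) : ∃ η > 0, X * η ≤ Y := by
  refine ⟨Y / (X + 1), by positivity, ?_⟩
  rw [mul_div_assoc', div_le_iff₀ (by positivity)]
  linarith

theorem mainTheorem7 (cp cd ct r : ℝ) (hcp : 0 ≤ cp) (hcd : 0 ≤ cd) (hct : 0 < ct) (hr : 0 ≤ r)
    (ρ : ℕ → ℝ) (hρ : ∀ n, 0 ≤ ρ n)
    (hρ_area : Tendsto (fun n : ℕ => (n : ℝ) * ρ n ^ 2) atTop (𝓝 0)) :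
    (∀ᶠ n in atTop, IsProbabilityMeasure (randomInstance n (ρ n))) ∧
    ∀ ε : ℝ, 0 < ε →
      Tendsto
        (fun n : ℕ => randomInstance n (ρ n) {ω | ¬ (
          |singleArmCost ω (cp + cd) ct / n - ((cp + cd) + meanSegmentLength * ct)| ≤ ε ∧
          (∃ P : TwoArmPlan ω cp cd ct r,
            P.makespan ≤
              (1 / 2 + 4 * Real.pi * r * ct / ((cp + cd) + meanSegmentLength * ct) + ε) *
                singleArmCost ω (cp + cd) ct) ∧
          (∀ P : TwoArmPlan ω cp cd ct r,
            (1 / 2 - ε) * singleArmCost ω (cp + cd) ct ≤ P.makespan))})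
        atTop (𝓝 0) := by
  refine ⟨?_, fun ε hε => ?_⟩
  · filter_upwards [eventually_exp_le_iidInstance_nonOverlapping hρ hρ_area one_pos] with n hn
    refine cond_isProbabilityMeasure fun h0 => ?_
    have h1 := hn.trans h0.le
    exact absurd (ENNReal.ofReal_eq_zero.1 (le_zero_iff.1 h1)) (not_le.2 (Real.exp_pos _))
  · have hκ := meanSegmentLength_pos
    set c := cp + cd + meanSegmentLength * ct with hc
    have hc0 : 0 < c := by positivity
    set θ := 1 / 2 + 4 * Real.pi * r * ct / c + ε with hθ
    have hθ0 : 0 ≤ θ := by positivity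
    set K := cp + cd + 16 * r * ct + ct * (12 + 10 * r) + θ * ct with hK
    have hK0 : 0 ≤ K := by positivity
    -- A single `η` for all the smallness conditions, each of which involves only part of `7 * ct +
    -- K`. Then `m` is taken large for `η`, and `δ` small for `m`.
    obtain ⟨η, hη, hηY⟩ := exists_pos_mul_le (X := 7 * ct + K) (Y := min ε (min (ε * c) (c / 2)))
      (by positivity) (by positivity)
    have hKη : 0 ≤ K * η := by positivity
    have hctη : 0 ≤ ct * η := by positivity
    have hY1 := hηY.trans (min_le_left _ _)
    have hY2 := hηY.trans ((min_le_right _ _).trans (min_le_left _ _))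
    have hY3 := hηY.trans ((min_le_right _ _).trans (min_le_right _ _))
    rw [add_mul] at hY1 hY2 hY3
    have hY4 : K * η ≤ ε * c := by linarith
    obtain ⟨m, hm⟩ := exists_nat_gt (√2 / η)
    have hm0 : (0 : ℝ) < m := (by positivity : 0 ≤ √2 / η).trans_lt hm
    obtain ⟨δ, hδ, hδY⟩ := exists_pos_mul_le (X := (m : ℝ) ^ 4 + 1) (Y := min η 1)
      (by positivity) (by positivity)
    have hδ1 := hδY.trans (min_le_left _ _)
    have hδ2 := hδY.trans (min_le_right _ _)
    have hδη : δ ≤ η := by nlinarith [pow_pos hm0 4]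
    refine tendsto_of_tendsto_of_tendsto_of_le_of_le' tendsto_const_nhds
      (tendsto_randomInstance_not_typical hρ hρ_area m hδ)
      (Eventually.of_forall fun _ => zero_le) ?_
    have hlarge : ∀ᶠ n : ℕ in atTop, 4 * (m : ℝ) ^ 4 ≤ η * n :=
      (tendsto_natCast_atTop_atTop.const_mul_atTop hη).eventually_ge_atTop _
    filter_upwards [hlarge, eventually_gt_atTop 0] with n hn hn0
    refine measure_mono fun ω hω => ?_
    by_contra htyp
    replace htyp : TypicalInstance m δ ω := not_not.1 htyp
    have hb := htyp.bounds (η := η) hcp hcd hct hr hn0 (by exact_mod_cast hm0)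
      (by
        rw [div_lt_iff₀ hη] at hm
        rw [div_le_iff₀ hm0]
        linarith) (by linarith) (by linarith) hn
    refine hω (singleArmCost_and_makespan_bounds hcp hcd hct hr hε hn0 hη
      (htyp.abs_sum_sub_le.trans (by gcongr)) hb.1 hb.2 (by linarith) (by linarith) (by linarith) hY4)
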